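/- **Setting.** Let $A$ be a $C^*$-algebra and $k\in\mathbb N$. A $C^*$-correspondence over $A$ is a (right) Hilbert $A$-module with a left action $\phi$ of $A$ by adjointable operators which is essential (the closed linear span of $\phi(A)E$ is $E$). Let $\mathbb E=(\mathbb E(n))_{n\in\mathbb N_0^k}$ be a product system of $C^*$-correspondences over $\mathbb N_0^k$: $\mathbb E(0)=A$, and there are associative multiplications inducing isomorphisms of correspondences $\mathbb E(m)\otimes_A\mathbb E(n)\cong\mathbb E(m+n)$, which are the module actions when $m=0$ or $n=0$. Let $e_1,\dots,e_k$ be the basis of $\mathbb N_0^k$, $E_i=\mathbb E(e_i)$, and let $t_{i,j}:E_i\otimes E_j\to E_j\otimes E_i$ be the isomorphism obtained by identifying both sides with $\mathbb E(e_i+e_j)$. A (completely contractive covariant) representation of $\mathbb E$ on a Hilbert space $H$ is a tuple $(\sigma,T^{(1)},\dots,T^{(k)})$, where $\sigma$ is a nondegenerate representation of $A$ on $H$ and $T^{(i)}:E_i\to B(H)$ are linear completely contractive maps with $T^{(i)}(a\xi b)=\sigma(a)T^{(i)}(\xi)\sigma(b)$ such that the operators $\widetilde T^{(i)}:E_i\otimes_\sigma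 H\to H$, $\widetilde T^{(i)}(\xi\otimes h)=T^{(i)}(\xi)h$, satisfy $\widetilde T^{(i)}(I_{E_i}\otimes\widetilde T^{(j)})=\widetilde T^{(j)}(I_{E_j}\otimes\widetilde T^{(i)})(t_{i,j}\otimes I_H)$ for all $i,j$. For $n\in\mathbb N_0^k$ let $\widetilde T(n):\mathbb E(n)\otimes_\sigma H\to H$ be the operator with $\widetilde T(n)(\xi_1\cdots\xi_r\otimes h)=T^{(i_1)}(\xi_1)\cdots T^{(i_r)}(\xi_r)h$ whenever $\xi_s\in E_{i_s}$ and $e_{i_1}+\dots+e_{i_r}=n$ (for $n=0$: $\widetilde T(0)(a\otimes h)=\sigma(a)h$). The representation is * *isometric* if $T^{(i)}(\xi)^*T^{(i)}(\eta)=\sigma(\langle\xi,\eta\rangle)$ for all $i$ and $\xi,\eta\in E_i$; * *fully coisometric* if $\widetilde T^{(i)}\widetilde T^{(i)*}=I_H$ for all $i$; * *doubly commuting* if $\widetilde T^{(j)*}\widetilde T^{(i)}=(I_{E_j}\otimes\widetilde T^{(i)})(t_{i,j}\otimes I_H)(I_{E_i}\otimes\widetilde T^{(j)*})$ for all $i\ne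 j$. A *minimal (regular) isometric dilation* of $(\sigma,T^{(1)},\dots,T^{(k)})$ is an isometric representation $(\sigma',V^{(1)},\dots,V^{(k)})$ of $\mathbb E$ on a Hilbert space $K\supseteq H$ such that $H$ reduces $\sigma'$ and $\sigma'|_H=\sigma$; every $V^{(i)}(\xi)^*$ leaves $H$ invariant; for all $m,n\in\mathbb N_0^k$ with $\min(m_i,n_i)=0$ for each $i$, $$(I_{\mathbb E(m)}\otimes P_H)\,\widetilde V(m)^*\,\widetilde V(n)|_{\mathbb E(n)\otimes_\sigma H}=\widetilde T(m)^*\,\widetilde T(n);$$ and $K$ is the only closed subspace of $K$ which contains $H$ and is invariant under all the operators $V^{(i)}(\xi)$, $\xi\in E_i$, $1\le i\le k$. **Proposition 2.5.** Let $(\sigma,T^{(1)},\dots,T^{(k)})$ be a doubly commuting completely contractive covariant representation of $\mathbb E$ on a Hilbert space $H$, and let $(\sigma',V^{(1)},\dots,V^{(k)})$ be its minimal isometric dilation. Then $(\sigma',V^{(1)},\dots,V^{(k)})$ is fully coisometric if and only if $(\sigma,T^{(1)},\dots,T^{(k)})$ is fully coisometric. -/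

import Mathlib

open scoped InnerProductSpace TensorProduct

namespace ProdSys

noncomputable section

set_option linter.unusedSectionVars false

/-- A `C⋆`-correspondence `E` over the `C⋆`-algebra `A`: a (right) Hilbert `C⋆`-module over `A`
whose `A`-valued inner product `ip` is linear in the second variable, together with a left action
of `A` by adjointable operators which is essential (nondegenerate). (The law
`⟨ξ, a • η⟩ = a * ⟨ξ, η⟩` of Mathlib's `CStarModule A E` is that of a left module, so it is not used
here.) The module axioms for the actions not listed below follow from the listed ones. -/
class Correspondence (A : Type*) [NonUnitalCStarAlgebra A] [PartialOrder A] [StarOrderedRing A]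
    (E : Type*) [NormedAddCommGroup E] [NormedSpace ℂ E] [CompleteSpace E] where
  /-- the right action `rsmul a ξ = ξ · a` -/
  rsmul : A →ₗ[ℂ] E →ₗ[ℂ] E
  rsmul_mul : ∀ (a b : A) (ξ : E), rsmul (a * b) ξ = rsmul b (rsmul a ξ)
  /-- the `A`-valued inner product `⟨ξ, η⟩` -/
  ip : E → E → A
  ip_add_right : ∀ ξ η ζ : E, ip ξ (η + ζ) = ip ξ η + ip ξ ζ
  ip_smul_right : ∀ (c : ℂ) (ξ η : E), ip ξ (c • η) = c • ip ξ η
  ip_rsmul_right : ∀ (a : A) (ξ η : E), ip ξ (rsmul a η) = ip ξ η * a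
  star_ip : ∀ ξ η : E, star (ip ξ η) = ip η ξ
  ip_self_nonneg : ∀ ξ : E, 0 ≤ ip ξ ξ
  norm_sq_eq : ∀ ξ : E, ‖ξ‖ ^ 2 = ‖ip ξ ξ‖
  /-- the left action `φ`; its values are adjointable by `ip_φ`, which also says `φ (a⋆) = φ(a)⋆` -/
  φ : A →ₗ[ℂ] E →ₗ[ℂ] E
  φ_mul : ∀ (a b : A) (ξ : E), φ (a * b) ξ = φ a (φ b ξ)
  ip_φ : ∀ (a : A) (ξ η : E), ip (φ a ξ) η = ip ξ (φ (star a) η)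
  /-- the closed linear span of `φ(A) E` is all of `E` -/
  essential : Dense (Submodule.span ℂ {ζ : E | ∃ (a : A) (ξ : E), φ a ξ = ζ} : Set E)

/-- A nondegenerate representation of the `C⋆`-algebra `A` on the Hilbert space `H`. -/
structure NDRep (A : Type*) [NonUnitalCStarAlgebra A] (H : Type*) [NormedAddCommGroup H]
    [InnerProductSpace ℂ H] [CompleteSpace H] where
  toHom : A →⋆ₙₐ[ℂ] (H →L[ℂ] H)
  nondegenerate : Dense (Submodule.span ℂ {g : H | ∃ (a : A) (h : H), toHom a h = g} : Set H)

instance {A : Type*} [NonUnitalCStarAlgebra A] {H : Type*} [NormedAddCommGroup H]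
    [InnerProductSpace ℂ H] [CompleteSpace H] : CoeFun (NDRep A H) fun _ => A → H →L[ℂ] H :=
  ⟨fun σ => σ.toHom⟩

section abstract

variable {M : Type*} [NonUnitalCStarAlgebra M] [PartialOrder M] [StarOrderedRing M]

/-- A self-adjoint element `G` is of the form `D⋆ D`, provided that elements `C` for which `-C⋆ C`
is a conjugate of `G` have to vanish. -/
theorem exists_sqrt_of_conj (G : M) (hGs : IsSelfAdjoint G)
    (hG : ∀ B C : M, star B * G * B + star C * C = 0 → C = 0) : ∃ D : M, G = star D * D := by
  have hB : 0 ≤ G⁻ := CFC.negPart_nonneg G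
  have hBs : star (G⁻) = G⁻ := (IsSelfAdjoint.of_nonneg hB).star_eq
  have h1 : star (G⁻) * G * G⁻ = -(G⁻ * G⁻ * G⁻) := by
    rw [hBs]
    nth_rewrite 2 [show G = G⁺ - G⁻ from (CFC.posPart_sub_negPart G hGs).symm]
    rw [mul_sub, sub_mul, CFC.negPart_mul_posPart]
    simp
  have h2 : 0 ≤ G⁻ * G⁻ * G⁻ := by
    have := star_left_conjugate_nonneg hB (G⁻)
    rwa [hBs] at this
  obtain ⟨C, hC⟩ := CStarAlgebra.nonneg_iff_eq_star_mul_self.mp h2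
  have h3 : C = 0 := hG (G⁻) C (by rw [h1, ← hC]; simp)
  have h9 : G⁻ = 0 := by
    have h10 : G⁻ * G⁻ * G⁻ = 0 := by rw [hC, h3]; simp
    have h11 : star (G⁻ * G⁻) * (G⁻ * G⁻) = 0 := by
      rw [star_mul, hBs, ← mul_assoc, h10, zero_mul]
    have h12 : star (G⁻) * G⁻ = 0 := by
      rw [hBs]; exact (CStarRing.star_mul_self_eq_zero_iff _).mp h11
    exact (CStarRing.star_mul_self_eq_zero_iff _).mp h12
  exact CStarAlgebra.nonneg_iff_eq_star_mul_self.mp ((CFC.negPart_eq_zero_iff G hGs).mp h9)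

/-- Approximate factorisation: `c⋆ c = G`, `‖b⋆ G b‖ ≤ 1` and `(1 - bc)⋆ G (1 - bc)` is small. -/
theorem exists_approx_factor (D : M) (ε : ℝ) (hε : 0 < ε) :
    ∃ b c : M, star c * c = star D * D ∧ ‖star b * (star D * D) * b‖ ≤ 1 ∧
      ‖(star D * D) - star (b * c) * (star D * D) - (star D * D) * (b * c)
        + star (b * c) * (star D * D) * (b * c)‖ ≤ ε := by
  have hG0 : 0 ≤ star D * D := star_mul_self_nonneg D
  set G := star D * D with hG
  have hGs : IsSelfAdjoint G := IsSelfAdjoint.of_nonneg hG0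
  have hspec : ∀ x ∈ quasispectrum ℝ G, 0 ≤ x := fun x hx => quasispectrum_nonneg_of_nonneg G hG0 x hx
  have hne : ∀ t : ℝ, |t| + ε ≠ 0 := fun t => by positivity
  have cf : Continuous fun t : ℝ => √t / (|t| + ε) := by fun_prop (disch := exact hne _)
  have cg : Continuous fun t : ℝ => √t := by fun_prop
  set f : ℝ → ℝ := fun t => √t / (|t| + ε) with hf
  have f0 : f 0 = 0 := by simp [hf]
  have bs : star (cfcₙ f G) = cfcₙ f G := (IsSelfAdjoint.cfcₙ (f := f) (a := G)).star_eq
  have cs : star (cfcₙ Real.sqrt G) = cfcₙ Real.sqrt G :=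
    (IsSelfAdjoint.cfcₙ (f := Real.sqrt) (a := G)).star_eq
  have hid : cfcₙ (fun t : ℝ => t) G = G := cfcₙ_id' ℝ G
  have hbc : cfcₙ f G * cfcₙ Real.sqrt G = cfcₙ (fun t => f t * √t) G :=
    (cfcₙ_mul f Real.sqrt G cf.continuousOn f0 cg.continuousOn (by simp)).symm
  set s : ℝ → ℝ := fun t => f t * √t with hs
  have cS : Continuous s := cf.mul cg
  have s0 : s 0 = 0 := by simp [hs]
  have ss : star (cfcₙ s G) = cfcₙ s G := (IsSelfAdjoint.cfcₙ (f := s) (a := G)).star_eq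
  refine ⟨cfcₙ f G, cfcₙ Real.sqrt G, ?_, ?_, ?_⟩
  · rw [cs, ← cfcₙ_mul Real.sqrt Real.sqrt G cg.continuousOn (by simp) cg.continuousOn (by simp)]
    conv_rhs => rw [← hid]
    exact cfcₙ_congr fun x hx => Real.mul_self_sqrt (hspec x hx)
  · rw [bs]
    have : cfcₙ f G * G * cfcₙ f G = cfcₙ (fun t => f t * t * f t) G := by
      conv_lhs => rw [← hid]
      rw [hid]
      nth_rewrite 2 [← hid]
      rw [← cfcₙ_mul f (fun t => t) G cf.continuousOn f0 continuous_id.continuousOn rfl,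
        ← cfcₙ_mul (fun t => f t * t) f G (cf.mul continuous_id).continuousOn (by simp)
          cf.continuousOn f0]
    rw [this]
    refine norm_cfcₙ_le fun x hx => ?_
    have hx0 := hspec x hx
    have : f x * x * f x = (x / (x + ε)) ^ 2 := by
      simp only [hf, abs_of_nonneg hx0]
      have := Real.mul_self_sqrt hx0
      have h2 : x + ε ≠ 0 := by positivity
      field_simp
      nlinarith
    rw [this, Real.norm_of_nonneg (by positivity)]
    refine pow_le_one₀ (by positivity) ?_
    rw [div_le_one (by positivity)]
    linarith
  · rw [hbc, ss]
    have e1 : cfcₙ s G * G = cfcₙ (fun t => s t * t) G := by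
      nth_rewrite 2 [← hid]
      rw [← cfcₙ_mul s (fun t => t) G cS.continuousOn s0 continuous_id.continuousOn rfl]
    have e2 : G * cfcₙ s G = cfcₙ (fun t => t * s t) G := by
      nth_rewrite 1 [← hid]
      rw [← cfcₙ_mul (fun t => t) s G continuous_id.continuousOn rfl cS.continuousOn s0]
    have e3 : cfcₙ s G * G * cfcₙ s G = cfcₙ (fun t => s t * t * s t) G := by
      rw [e1, ← cfcₙ_mul (fun t => s t * t) s G (cS.mul continuous_id).continuousOn (by simp)
        cS.continuousOn s0]
    have c1 : Continuous fun t => s t * t := cS.mul continuous_id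
    have c2 : Continuous fun t => t * s t := continuous_id.mul cS
    have c3 : Continuous fun t => s t * t * s t := c1.mul cS
    have e4 : G - cfcₙ s G * G - G * cfcₙ s G + cfcₙ s G * G * cfcₙ s G
        = cfcₙ (fun t => t - s t * t - t * s t + s t * t * s t) G := by
      rw [e3, e1, e2]
      nth_rewrite 1 [← hid]
      rw [← cfcₙ_sub (fun t => t) (fun t => s t * t) G continuous_id.continuousOn rfl
          c1.continuousOn (by simp),
        ← cfcₙ_sub (fun t => t - s t * t) (fun t => t * s t) G
          (continuous_id.sub c1).continuousOn (by simp) c2.continuousOn (by simp),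
        ← cfcₙ_add (fun t => t - s t * t - t * s t) (fun t => s t * t * s t) G
          ((continuous_id.sub c1).sub c2).continuousOn (by simp) c3.continuousOn (by simp)]
    rw [e4]
    refine norm_cfcₙ_le fun x hx => ?_
    have hx0 := hspec x hx
    have h2 : x + ε ≠ 0 := by positivity
    have hsx : s x = x / (x + ε) := by
      simp only [hs, hf, abs_of_nonneg hx0]
      have := Real.mul_self_sqrt hx0
      field_simp
      nlinarith
    have : x - s x * x - x * s x + s x * x * s x = ε * (x / (x + ε)) * (ε / (x + ε)) := by
      rw [hsx]; field_simp; ring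
    rw [this, Real.norm_of_nonneg (by positivity)]
    have a1 : x / (x + ε) ≤ 1 := by rw [div_le_one (by positivity)]; linarith
    have a2 : ε / (x + ε) ≤ 1 := by rw [div_le_one (by positivity)]; linarith
    calc ε * (x / (x + ε)) * (ε / (x + ε)) ≤ ε * 1 * 1 := by gcongr
      _ = ε := by ring

end abstract

section gram

variable {A : Type*} [NonUnitalCStarAlgebra A] [PartialOrder A] [StarOrderedRing A]
variable {E : Type*} [NormedAddCommGroup E] [NormedSpace ℂ E] [CompleteSpace E]
  [Correspondence A E]
variable {H : Type*} [NormedAddCommGroup H] [InnerProductSpace ℂ H] [CompleteSpace H]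

open Correspondence

/-- `ip` as a sesquilinear map. -/
def ipₛₗ (A : Type*) [NonUnitalCStarAlgebra A] [PartialOrder A] [StarOrderedRing A]
    {E : Type*} [NormedAddCommGroup E] [NormedSpace ℂ E] [CompleteSpace E]
    [Correspondence A E] : E →ₗ⋆[ℂ] E →ₗ[ℂ] A :=
  LinearMap.mk₂'ₛₗ (starRingEnd ℂ) (RingHom.id ℂ) (fun ξ η => ip ξ η)
    (fun ξ η ζ => by rw [← star_ip, ip_add_right, star_add, star_ip, star_ip])
    (fun c ξ η => by rw [← star_ip, ip_smul_right, star_smul, star_ip]; rfl)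
    (fun ξ η ζ => ip_add_right ξ η ζ) (fun c ξ η => ip_smul_right c ξ η)

theorem ip_sum_right {ι : Type*} (s : Finset ι) (ξ : E) (η : ι → E) :
    (ip ξ (∑ i ∈ s, η i) : A) = ∑ i ∈ s, ip ξ (η i) :=
  map_sum (ipₛₗ A ξ) _ _

theorem ip_sum_left {ι : Type*} (s : Finset ι) (ξ : ι → E) (η : E) :
    (ip (∑ i ∈ s, ξ i) η : A) = ∑ i ∈ s, ip (ξ i) η :=
  map_sum ((ipₛₗ A (E := E)).flip η) _ _

theorem ip_rsmul_left (a : A) (ξ η : E) : (ip (rsmul a ξ) η : A) = star a * ip ξ η := by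
  rw [← star_ip, ip_rsmul_right, star_mul, star_ip]

theorem ip_sub_left (ξ ξ' η : E) : (ip (ξ - ξ') η : A) = ip ξ η - ip ξ' η :=
  map_sub ((ipₛₗ A (E := E)).flip η) _ _

theorem ip_sub_right (ξ η η' : E) : (ip ξ (η - η') : A) = ip ξ η - ip ξ η' :=
  map_sub (ipₛₗ A ξ) _ _

/-- The Gram matrix `(⟨ξ i, ξ j⟩)` of a finite family. -/
def gram (A : Type*) [NonUnitalCStarAlgebra A] [PartialOrder A] [StarOrderedRing A]
    {E : Type*} [NormedAddCommGroup E] [NormedSpace ℂ E] [CompleteSpace E]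
    [Correspondence A E] {ι : Type*} (ξ : ι → E) : CStarMatrix ι ι A :=
  CStarMatrix.ofMatrix (Matrix.of fun i j => ip (ξ i) (ξ j))

theorem gram_apply {ι : Type*} (ξ : ι → E) (i j : ι) : gram A ξ i j = ip (ξ i) (ξ j) := rfl

/-- The family `(∑ k, ξ k · b k j)_j`. -/
def rowMul {ι : Type*} [Fintype ι] (ξ : ι → E) (B : CStarMatrix ι ι A) (j : ι) : E :=
  ∑ k, rsmul (B k j) (ξ k)

theorem gram_rowMul {ι : Type*} [Fintype ι] (ξ : ι → E) (B : CStarMatrix ι ι A) :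
    gram A (rowMul ξ B) = star B * gram A ξ * B := by
  ext i j
  simp only [gram_apply, rowMul, ip_sum_left, ip_sum_right, ip_rsmul_left, ip_rsmul_right,
    CStarMatrix.mul_apply, CStarMatrix.star_apply, Finset.sum_mul, mul_assoc]

theorem gram_sub_rowMul {ι : Type*} [Fintype ι] (ξ : ι → E) (B : CStarMatrix ι ι A) :
    gram A (fun i => ξ i - rowMul ξ B i) =
      gram A ξ - star B * gram A ξ - gram A ξ * B + star B * gram A ξ * B := by
  rw [← gram_rowMul]
  ext i j
  simp only [gram_apply, ip_sub_left, ip_sub_right, CStarMatrix.add_apply, CStarMatrix.sub_apply,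
    CStarMatrix.mul_apply, CStarMatrix.star_apply, rowMul, ip_sum_left, ip_sum_right,
    ip_rsmul_left, ip_rsmul_right, sub_mul, Finset.sum_sub_distrib]
  abel

theorem exists_gram_sqrt {ι : Type*} [Fintype ι] (ξ : ι → E) :
    ∃ D : CStarMatrix ι ι A, gram A ξ = star D * D := by
  refine exists_sqrt_of_conj (M := CStarMatrix ι ι A) (gram A ξ) ?_ fun B C hBC => ?_
  · ext i j
    rw [CStarMatrix.star_apply]
    exact star_ip _ _
  · rw [← gram_rowMul] at hBC
    ext k i
    have h4 : ip (rowMul ξ B i) (rowMul ξ B i) + ∑ k, star (C k i) * C k i = 0 := by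
      have := congrFun (congrFun hBC i) i
      rw [CStarMatrix.add_apply, CStarMatrix.mul_apply] at this
      exact this
    have h6 : ∀ k ∈ Finset.univ, 0 ≤ star (C k i) * C k i := fun k _ => star_mul_self_nonneg _
    have h7 : (∑ k, star (C k i) * C k i) = 0 :=
      ((add_eq_zero_iff_of_nonneg (ip_self_nonneg _) (Finset.sum_nonneg h6)).mp h4).2
    have h8 := (Finset.sum_eq_zero_iff_of_nonneg h6).mp h7 k (Finset.mem_univ k)
    exact (CStarRing.star_mul_self_eq_zero_iff _).mp h8

/-- `∑ ⟨h i, σ((C⋆C) i j) h j⟩` as a sum of squares. -/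
theorem sum_inner_star_mul (σ : NDRep A H) {ι : Type*} [Fintype ι] (C : CStarMatrix ι ι A)
    (h : ι → H) :
    ∑ i, ∑ j, ⟪h i, σ ((star C * C) i j) (h j)⟫_ℂ
      = ((∑ k, ‖∑ j, σ (C k j) (h j)‖ ^ 2 : ℝ) : ℂ) := by
  have h1 : ∀ i j, ⟪h i, σ ((star C * C) i j) (h j)⟫_ℂ
      = ∑ k, ⟪σ (C k i) (h i), σ (C k j) (h j)⟫_ℂ := by
    intro i j
    have : (star C * C) i j = ∑ k, star (C k i) * C k j := by
      rw [CStarMatrix.mul_apply]; rfl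
    rw [this, map_sum, _root_.sum_apply, inner_sum]
    refine Finset.sum_congr rfl fun k _ => ?_
    rw [map_mul, map_star, mul_apply_eq_comp, ContinuousLinearMap.star_eq_adjoint,
      ContinuousLinearMap.adjoint_inner_right]
  have h2 : ∀ k, ((‖∑ j, σ (C k j) (h j)‖ ^ 2 : ℝ) : ℂ)
      = ∑ i, ∑ j, ⟪σ (C k i) (h i), σ (C k j) (h j)⟫_ℂ := by
    intro k
    have := inner_self_eq_norm_sq_to_K (𝕜 := ℂ) (∑ j, σ (C k j) (h j))
    rw [sum_inner] at this
    simp only [inner_sum] at this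
    rw [this]
    simp
  rw [Complex.ofReal_sum]
  simp only [h1, h2]
  conv_rhs => rw [Finset.sum_comm]
  refine Finset.sum_congr rfl fun i _ => ?_
  rw [Finset.sum_comm]

end gram

section tensor

open Correspondence

variable {A : Type*} [NonUnitalCStarAlgebra A] [PartialOrder A] [StarOrderedRing A]
variable (E : Type*) [NormedAddCommGroup E] [NormedSpace ℂ E] [CompleteSpace E]
  [Correspondence A E]
variable {H : Type*} [NormedAddCommGroup H] [InnerProductSpace ℂ H] [CompleteSpace H]
variable (σ : NDRep A H)

/-- The semi-inner product on the algebraic tensor product `E ⊗ H` determined by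
`⟪ξ ⊗ h, η ⊗ g⟫ = ⟪h, σ(⟨ξ, η⟩) g⟫`. -/
def tensorForm : (E ⊗[ℂ] H) →ₗ⋆[ℂ] (E ⊗[ℂ] H) →ₗ[ℂ] ℂ :=
  TensorProduct.lift (LinearMap.mk₂'ₛₗ (starRingEnd ℂ) (starRingEnd ℂ)
    (fun (ξ : E) (h : H) => TensorProduct.lift (LinearMap.mk₂ ℂ
      (fun (η : E) (g : H) => ⟪h, σ (ip ξ η) g⟫_ℂ)
      (fun η η' g => by rw [ip_add_right, map_add, add_apply, inner_add_right])
      (fun c η g => by rw [ip_smul_right, map_smul, smul_apply, inner_smul_right]; rfl)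
      (fun η g g' => by rw [map_add, inner_add_right])
      (fun c η g => by rw [map_smul, inner_smul_right]; rfl)))
    (fun ξ ξ' h => by
      ext η g
      have : (ip (ξ + ξ') η : A) = ip ξ η + ip ξ' η := by
        rw [← star_ip, ip_add_right, star_add, star_ip, star_ip]
      simp [this])
    (fun c ξ h => by
      ext η g
      have : (ip (c • ξ) η : A) = star c • ip ξ η := by
        rw [← star_ip, ip_smul_right, star_smul, star_ip]
      simp [this])
    (fun ξ h h' => by ext η g; simp)
    (fun c ξ h => by ext η g; simp [mul_comm]))

variable {E}

@[simp] theorem tensorForm_tmul (ξ η : E) (h g : H) :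
    tensorForm E σ (ξ ⊗ₜ h) (η ⊗ₜ g) = ⟪h, σ (ip ξ η) g⟫_ℂ := rfl

theorem exists_sum_tmul (x : E ⊗[ℂ] H) :
    ∃ (n : ℕ) (ξ : Fin n → E) (h : Fin n → H), x = ∑ i, ξ i ⊗ₜ[ℂ] h i := by
  obtain ⟨s, rfl⟩ := TensorProduct.exists_finset x
  refine ⟨s.card, fun i => (s.equivFin.symm i).1.1, fun i => (s.equivFin.symm i).1.2, ?_⟩
  rw [← Finset.sum_coe_sort]
  exact (Equiv.sum_comp s.equivFin.symm (fun p : s => p.1.1 ⊗ₜ[ℂ] p.1.2)).symm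

theorem tensorForm_sum {ι : Type*} [Fintype ι] (ξ : ι → E) (h : ι → H) :
    tensorForm E σ (∑ i, ξ i ⊗ₜ h i) (∑ i, ξ i ⊗ₜ h i)
      = ∑ i, ∑ j, ⟪h i, σ (gram A ξ i j) (h j)⟫_ℂ := by
  simp [map_sum, LinearMap.sum_apply, gram_apply]
  exact Finset.sum_comm

theorem tensorForm_conj (x y : E ⊗[ℂ] H) :
    starRingEnd ℂ (tensorForm E σ y x) = tensorForm E σ x y := by
  induction x with
  | zero => simp
  | add x x' hx hx' => simp [hx, hx']
  | tmul ξ h =>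
    induction y with
    | zero => simp
    | add y y' hy hy' => simp [hy, hy']
    | tmul η g =>
      rw [tensorForm_tmul, tensorForm_tmul, inner_conj_symm, ← star_ip, map_star,
        ContinuousLinearMap.star_eq_adjoint, ContinuousLinearMap.adjoint_inner_left]

/-- The algebraic tensor product `E ⊗ H` with the seminorm coming from `tensorForm`. -/
def PreTensor (E : Type*) [NormedAddCommGroup E] [NormedSpace ℂ E] [CompleteSpace E]
    [Correspondence A E] (_ : NDRep A H) : Type _ := E ⊗[ℂ] H

instance : AddCommGroup (PreTensor E σ) := inferInstanceAs (AddCommGroup (E ⊗[ℂ] H))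
instance : Module ℂ (PreTensor E σ) := inferInstanceAs (Module ℂ (E ⊗[ℂ] H))

theorem tensorForm_self_nonneg (x : E ⊗[ℂ] H) : 0 ≤ (tensorForm E σ x x).re := by
  obtain ⟨n, ξ, h, rfl⟩ := exists_sum_tmul x
  obtain ⟨D, hD⟩ := exists_gram_sqrt (A := A) ξ
  rw [tensorForm_sum, hD, sum_inner_star_mul, Complex.ofReal_re]
  positivity

@[reducible]
def PreTensor.core : PreInnerProductSpace.Core ℂ (PreTensor E σ) where
  inner x y := tensorForm E σ x y
  conj_inner_symm x y := tensorForm_conj σ x y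
  re_inner_nonneg x := tensorForm_self_nonneg σ x
  add_left x y z := congrFun (congrArg DFunLike.coe (map_add (tensorForm E σ) x y)) z
  smul_left x y r := congrFun (congrArg DFunLike.coe ((tensorForm E σ).map_smulₛₗ r x)) y

instance : SeminormedAddCommGroup (PreTensor E σ) :=
  @InnerProductSpace.Core.toSeminormedAddCommGroup ℂ (PreTensor E σ) _ _ _ (PreTensor.core σ)

instance : InnerProductSpace ℂ (PreTensor E σ) := InnerProductSpace.ofCore (PreTensor.core σ)

theorem PreTensor.inner_def (x y : PreTensor E σ) : ⟪x, y⟫_ℂ = tensorForm E σ x y := rfl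

variable (E) in
/-- The interior tensor product `E ⊗_σ H`: the Hausdorff completion of the algebraic tensor
product `E ⊗ H` for `⟪ξ ⊗ h, η ⊗ g⟫ = ⟪h, σ(⟨ξ, η⟩) g⟫`. -/
def Tensor : Type _ := UniformSpace.Completion (PreTensor E σ)

instance : NormedAddCommGroup (Tensor E σ) :=
  inferInstanceAs (NormedAddCommGroup (UniformSpace.Completion (PreTensor E σ)))

instance : InnerProductSpace ℂ (Tensor E σ) :=
  inferInstanceAs (InnerProductSpace ℂ (UniformSpace.Completion (PreTensor E σ)))

instance : CompleteSpace (Tensor E σ) :=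
  inferInstanceAs (CompleteSpace (UniformSpace.Completion (PreTensor E σ)))

/-- The canonical map from the algebraic tensor product to `E ⊗_σ H`. -/
def Tensor.ofAlg : (E ⊗[ℂ] H) →ₗ[ℂ] Tensor E σ :=
  (UniformSpace.Completion.toComplL (𝕜 := ℂ) (E := PreTensor E σ)).toLinearMap

theorem Tensor.denseRange_ofAlg : DenseRange (Tensor.ofAlg (E := E) σ) :=
  UniformSpace.Completion.denseRange_coe (α := PreTensor E σ)

/-- The elementary tensor `ξ ⊗ h ∈ E ⊗_σ H`. -/
def Tensor.tmul (ξ : E) (h : H) : Tensor E σ := Tensor.ofAlg σ (ξ ⊗ₜ h)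

theorem Tensor.inner_ofAlg (x y : E ⊗[ℂ] H) :
    ⟪Tensor.ofAlg σ x, Tensor.ofAlg σ y⟫_ℂ = tensorForm E σ x y :=
  UniformSpace.Completion.inner_coe (𝕜 := ℂ) (E := PreTensor E σ) x y

theorem Tensor.inner_tmul (ξ η : E) (h g : H) :
    ⟪Tensor.tmul σ ξ h, Tensor.tmul σ η g⟫_ℂ = ⟪h, σ (ip ξ η) g⟫_ℂ := Tensor.inner_ofAlg σ _ _

theorem Tensor.norm_sq_ofAlg (x : E ⊗[ℂ] H) :
    ‖Tensor.ofAlg σ x‖ ^ 2 = (tensorForm E σ x x).re := by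
  rw [← Tensor.inner_ofAlg, ← inner_self_eq_norm_sq (𝕜 := ℂ)]
  rfl

theorem Tensor.norm_sq_sum {n : ℕ} (ξ : Fin n → E) (h : Fin n → H) (D : CStarMatrix (Fin n) (Fin n) A)
    (hD : gram A ξ = star D * D) :
    ‖Tensor.ofAlg σ (∑ i, ξ i ⊗ₜ[ℂ] h i)‖ ^ 2 = ∑ k, ‖∑ j, σ (D k j) (h j)‖ ^ 2 := by
  rw [Tensor.norm_sq_ofAlg, tensorForm_sum, hD, sum_inner_star_mul, Complex.ofReal_re]

/-- A closed property which holds for sums and elementary tensors holds on `E ⊗_σ H`. -/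
theorem Tensor.induction {p : Tensor E σ → Prop} (hc : IsClosed {x | p x}) (h0 : p 0)
    (ha : ∀ x y, p x → p y → p (x + y)) (ht : ∀ ξ h, p (Tensor.tmul σ ξ h)) (x : Tensor E σ) :
    p x := by
  refine (Tensor.denseRange_ofAlg σ).induction_on (p := p) x hc fun x => ?_
  induction x with
  | zero => rw [map_zero]; exact h0
  | add x y hx hy => rw [map_add]; exact ha _ _ hx hy
  | tmul ξ h => exact ht ξ h

theorem Tensor.ext {W : Type*} [NormedAddCommGroup W] [NormedSpace ℂ W]
    {X Y : Tensor E σ →L[ℂ] W}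
    (hXY : ∀ ξ h, X (Tensor.tmul σ ξ h) = Y (Tensor.tmul σ ξ h)) : X = Y := by
  ext x
  induction x using Tensor.induction with
  | hc => exact isClosed_eq X.continuous Y.continuous
  | h0 => simp
  | ha x y hx hy => simp [hx, hy]
  | ht ξ h => exact hXY ξ h

/-- The bounded operator on `E ⊗_σ H` extending a bounded operator on algebraic tensors. -/
def Tensor.lift {W : Type*} [NormedAddCommGroup W] [NormedSpace ℂ W] [CompleteSpace W]
    (f : (E ⊗[ℂ] H) →ₗ[ℂ] W) : Tensor E σ →L[ℂ] W :=
  f.extendOfNorm (Tensor.ofAlg σ)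

theorem Tensor.lift_ofAlg {W : Type*} [NormedAddCommGroup W] [NormedSpace ℂ W] [CompleteSpace W]
    (f : (E ⊗[ℂ] H) →ₗ[ℂ] W) (C : ℝ) (hf : ∀ x, ‖f x‖ ≤ C * ‖Tensor.ofAlg σ x‖) (x : E ⊗[ℂ] H) :
    Tensor.lift σ f (Tensor.ofAlg σ x) = f x :=
  LinearMap.extendOfNorm_eq (Tensor.denseRange_ofAlg σ) ⟨C, hf⟩ x

theorem Tensor.norm_tmul_le (ξ : E) (h : H) : ‖Tensor.tmul σ ξ h‖ ≤ ‖ξ‖ * ‖h‖ := by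
  refine le_of_sq_le_sq ?_ (by positivity)
  have h1 : ‖Tensor.tmul σ ξ h‖ ^ 2 = (⟪h, σ (ip ξ ξ) h⟫_ℂ).re := by
    rw [← Tensor.inner_tmul, ← inner_self_eq_norm_sq (𝕜 := ℂ)]; rfl
  rw [h1]
  have h2 : ‖σ (ip ξ ξ)‖ ≤ ‖ξ‖ ^ 2 := by
    rw [norm_sq_eq (A := A)]
    exact NonUnitalStarAlgHom.norm_apply_le σ.toHom _
  calc (⟪h, σ (ip ξ ξ) h⟫_ℂ).re ≤ ‖⟪h, σ (ip ξ ξ) h⟫_ℂ‖ := Complex.re_le_norm _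
    _ ≤ ‖h‖ * ‖σ (ip ξ ξ) h‖ := norm_inner_le_norm _ _
    _ ≤ ‖h‖ * (‖σ (ip ξ ξ)‖ * ‖h‖) := by gcongr; exact (σ (ip ξ ξ)).le_opNorm h
    _ ≤ ‖h‖ * (‖ξ‖ ^ 2 * ‖h‖) := by gcongr
    _ = (‖ξ‖ * ‖h‖) ^ 2 := by ring

end tensor

section operators

open Correspondence

variable {A : Type*} [NonUnitalCStarAlgebra A] [PartialOrder A] [StarOrderedRing A]
variable {E : Type*} [NormedAddCommGroup E] [NormedSpace ℂ E] [CompleteSpace E]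
  [Correspondence A E]
variable {F : Type*} [NormedAddCommGroup F] [NormedSpace ℂ F] [CompleteSpace F]
  [Correspondence A F]
variable {G : Type*} [NormedAddCommGroup G] [NormedSpace ℂ G] [CompleteSpace G]
  [Correspondence A G]
variable {H : Type*} [NormedAddCommGroup H] [InnerProductSpace ℂ H] [CompleteSpace H]
variable {K : Type*} [NormedAddCommGroup K] [InnerProductSpace ℂ K] [CompleteSpace K]
variable {L : Type*} [NormedAddCommGroup L] [InnerProductSpace ℂ L] [CompleteSpace L]
variable (σ : NDRep A H) (ρ : NDRep A K) (τ : NDRep A L)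

/-- `X` intertwines the representations `σ` and `ρ`. -/
def Intertwines (X : H →L[ℂ] K) : Prop := ∀ (a : A) (h : H), X (σ a h) = ρ a (X h)

variable {σ ρ τ} in
theorem Intertwines.comp {Y : K →L[ℂ] L} {X : H →L[ℂ] K} (hY : Intertwines ρ τ Y)
    (hX : Intertwines σ ρ X) : Intertwines σ τ (Y ∘L X) := fun a h => by simp [hX a h, hY a (X h)]

variable {σ ρ} in
theorem Intertwines.adjoint {X : H →L[ℂ] K} (hX : Intertwines σ ρ X) :
    Intertwines ρ σ (ContinuousLinearMap.adjoint X) := fun a k => by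
  refine ext_inner_left ℂ fun h => ?_
  have h1 : ∀ (b : A) (x y : H), ⟪x, σ b y⟫_ℂ = ⟪σ (star b) x, y⟫_ℂ := fun b x y => by
    rw [map_star, ContinuousLinearMap.star_eq_adjoint, ContinuousLinearMap.adjoint_inner_left]
  have h2 : ∀ (b : A) (x y : K), ⟪x, ρ b y⟫_ℂ = ⟪ρ (star b) x, y⟫_ℂ := fun b x y => by
    rw [map_star, ContinuousLinearMap.star_eq_adjoint, ContinuousLinearMap.adjoint_inner_left]
  rw [ContinuousLinearMap.adjoint_inner_right, h1, h2, ContinuousLinearMap.adjoint_inner_right,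
    hX]

variable (E) in
/-- The operator `I_E ⊗ X : E ⊗_σ H → E ⊗_ρ K`, for `X` intertwining `σ` and `ρ`. -/
def Tensor.map (X : H →L[ℂ] K) (_ : Intertwines σ ρ X) : Tensor E σ →L[ℂ] Tensor E ρ :=
  Tensor.lift σ (Tensor.ofAlg ρ ∘ₗ LinearMap.lTensor E (X : H →ₗ[ℂ] K))

@[simp] theorem Tensor.map_tmul (X : H →L[ℂ] K) (hX : Intertwines σ ρ X) (ξ : E) (h : H) :
    Tensor.map E σ ρ X hX (Tensor.tmul σ ξ h) = Tensor.tmul ρ ξ (X h) := by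
  refine (Tensor.lift_ofAlg σ _ ‖X‖ (fun x => ?_) _).trans rfl
  obtain ⟨n, ξ, h, rfl⟩ := exists_sum_tmul x
  obtain ⟨D, hD⟩ := exists_gram_sqrt (A := A) ξ
  refine le_of_sq_le_sq ?_ (by positivity)
  rw [mul_pow, Tensor.norm_sq_sum σ ξ h D hD]
  have : (Tensor.ofAlg ρ ∘ₗ LinearMap.lTensor E (X : H →ₗ[ℂ] K)) (∑ i, ξ i ⊗ₜ[ℂ] h i)
      = Tensor.ofAlg ρ (∑ i, ξ i ⊗ₜ[ℂ] X (h i)) := by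
    simp [map_sum]
  rw [this, Tensor.norm_sq_sum ρ ξ _ D hD, Finset.mul_sum]
  refine Finset.sum_le_sum fun k _ => ?_
  have : ∑ j, ρ (D k j) (X (h j)) = X (∑ j, σ (D k j) (h j)) := by
    rw [map_sum]; exact Finset.sum_congr rfl fun j _ => (hX _ _).symm
  rw [this, ← mul_pow]
  gcongr
  exact X.le_opNorm _

/-- `φ(a) ⊗ I` on the algebraic tensor product. -/
def act (E H : Type*) [NormedAddCommGroup E] [NormedSpace ℂ E] [CompleteSpace E]
    [Correspondence A E] [NormedAddCommGroup H] [InnerProductSpace ℂ H] (a : A) :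
    (E ⊗[ℂ] H) →ₗ[ℂ] (E ⊗[ℂ] H) := LinearMap.rTensor H (φ a)

theorem act_tmul (a : A) (ξ : E) (h : H) : act E H a (ξ ⊗ₜ h) = φ a ξ ⊗ₜ h := rfl

theorem act_mul (a b : A) (x : E ⊗[ℂ] H) : act E H (a * b) x = act E H a (act E H b x) := by
  induction x with
  | zero => simp
  | add x y hx hy => simp [hx, hy]
  | tmul ξ h => simp only [act_tmul, φ_mul]

theorem act_add (a b : A) (x : E ⊗[ℂ] H) : act E H (a + b) x = act E H a x + act E H b x := by
  simp [act, LinearMap.rTensor_add]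

theorem act_smul (c : ℂ) (a : A) (x : E ⊗[ℂ] H) : act E H (c • a) x = c • act E H a x := by
  simp [act, LinearMap.rTensor_smul]

theorem tensorForm_act (a : A) (x y : E ⊗[ℂ] H) :
    tensorForm E σ (act E H a x) y = tensorForm E σ x (act E H (star a) y) := by
  induction x with
  | zero => simp
  | add x x' hx hx' => simp [hx, hx']
  | tmul ξ h =>
    induction y with
    | zero => simp
    | add y y' hy hy' => simp only [map_add, hy, hy']
    | tmul η g => rw [act_tmul, act_tmul, tensorForm_tmul, tensorForm_tmul, ip_φ]

theorem exists_defect (a : A) :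
    ∃ d : A, IsSelfAdjoint d ∧ star a * a = ((2 * ‖a‖ : ℝ) : ℂ) • d - d * d := by
  set M := ‖a‖ with hM
  set f : ℝ → ℝ := fun t => M - √(M ^ 2 - t) with hf
  have cf : Continuous f := by fun_prop
  have f0 : f 0 = 0 := by simp [hf, hM, Real.sqrt_sq]
  have hs : IsSelfAdjoint (star a * a) := .star_mul_self a
  refine ⟨cfcₙ f (star a * a), IsSelfAdjoint.cfcₙ, ?_⟩
  have c2 : Continuous fun t => (2 * M) • f t := continuous_const.mul cf
  rw [← cfcₙ_mul f f _ cf.continuousOn f0 cf.continuousOn f0]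
  rw [Complex.coe_smul, ← cfcₙ_smul (2 * M) f _ cf.continuousOn f0,
    ← cfcₙ_sub (fun t => (2 * M) • f t) (fun t => f t * f t) _ c2.continuousOn
      (by simp [f0]) (cf.mul cf).continuousOn (by simp [f0])]
  conv_lhs => rw [← cfcₙ_id' ℝ (star a * a)]
  refine cfcₙ_congr fun t ht => ?_
  have h1 : t ≤ M ^ 2 := by
    have h2 : ‖t‖ ≤ ‖star a * a‖ := by
      have := norm_apply_le_norm_cfcₙ (fun x : ℝ => x) (star a * a) ht continuous_id.continuousOn rfl hs
      rwa [cfcₙ_id' ℝ (star a * a)] at this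
    rw [CStarRing.norm_star_mul_self] at h2
    calc t ≤ ‖t‖ := Real.le_norm_self t
      _ ≤ M ^ 2 := by rw [sq]; exact h2
  have h3 := Real.mul_self_sqrt (sub_nonneg.mpr h1)
  simp only [hf, smul_eq_mul]
  nlinarith

theorem norm_act_le (a : A) (x : E ⊗[ℂ] H) :
    ‖Tensor.ofAlg σ (act E H a x)‖ ≤ ‖a‖ * ‖Tensor.ofAlg σ x‖ := by
  obtain ⟨d, hd, had⟩ := exists_defect a
  refine le_of_sq_le_sq ?_ (by positivity)
  rw [mul_pow, Tensor.norm_sq_ofAlg, Tensor.norm_sq_ofAlg, tensorForm_act, ← act_mul, had]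
  have h1 : act E H (((2 * ‖a‖ : ℝ) : ℂ) • d - d * d) x
      = ((2 * ‖a‖ : ℝ) : ℂ) • act E H d x - act E H d (act E H d x) := by
    rw [sub_eq_add_neg, ← neg_one_smul ℂ (d * d), act_add, act_smul, act_smul, act_mul]
    simp [sub_eq_add_neg]
  have h2 := tensorForm_self_nonneg σ ((‖a‖ : ℂ) • x - act E H d x)
  have h4 : (tensorForm E σ (act E H d x) x) = tensorForm E σ x (act E H d x) := by
    rw [tensorForm_act, hd.star_eq]
  have h5 : (tensorForm E σ (act E H d x) (act E H d x))
      = tensorForm E σ x (act E H d (act E H d x)) := by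
    rw [tensorForm_act, hd.star_eq]
  rw [h1]
  simp only [map_sub, LinearMap.sub_apply, LinearMap.map_smulₛₗ, LinearMap.smul_apply,
    smul_eq_mul, h4, h5, Complex.conj_ofReal, map_smul] at h2 ⊢
  simp only [Complex.sub_re, Complex.re_ofReal_mul] at h2 ⊢
  nlinarith

/-- `φ(a) ⊗ I` on `E ⊗_σ H`. -/
def Tensor.act (a : A) : Tensor E σ →L[ℂ] Tensor E σ :=
  Tensor.lift σ (Tensor.ofAlg σ ∘ₗ ProdSys.act E H a)

theorem Tensor.act_ofAlg (a : A) (x : E ⊗[ℂ] H) :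
    Tensor.act σ a (Tensor.ofAlg σ x) = Tensor.ofAlg σ (ProdSys.act E H a x) :=
  Tensor.lift_ofAlg σ _ ‖a‖ (norm_act_le σ a) x

theorem Tensor.act_tmul (a : A) (ξ : E) (h : H) :
    Tensor.act σ a (Tensor.tmul σ ξ h) = Tensor.tmul σ (φ a ξ) h := Tensor.act_ofAlg σ a _

theorem Tensor.tmul_add_left (ξ ξ' : E) (h : H) :
    Tensor.tmul σ (ξ + ξ') h = Tensor.tmul σ ξ h + Tensor.tmul σ ξ' h := by
  simp [Tensor.tmul, TensorProduct.add_tmul]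

theorem Tensor.tmul_smul_left (c : ℂ) (ξ : E) (h : H) :
    Tensor.tmul σ (c • ξ) h = c • Tensor.tmul σ ξ h := by
  rw [Tensor.tmul, ← TensorProduct.smul_tmul', map_smul]; rfl

theorem Tensor.tmul_add_right (ξ : E) (h h' : H) :
    Tensor.tmul σ ξ (h + h') = Tensor.tmul σ ξ h + Tensor.tmul σ ξ h' := by
  simp [Tensor.tmul, TensorProduct.tmul_add]

theorem Tensor.tmul_smul_right (c : ℂ) (ξ : E) (h : H) :
    Tensor.tmul σ ξ (c • h) = c • Tensor.tmul σ ξ h := by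
  simp [Tensor.tmul, TensorProduct.tmul_smul]

theorem Tensor.continuous_tmul_right (ξ : E) : Continuous fun h : H => Tensor.tmul σ ξ h :=
  (LinearMap.mkContinuous
    ({ toFun := fun h => Tensor.tmul σ ξ h
       map_add' := fun h h' => Tensor.tmul_add_right σ ξ h h'
       map_smul' := fun c h => Tensor.tmul_smul_right σ c ξ h } : H →ₗ[ℂ] Tensor E σ)
    ‖ξ‖ fun h => Tensor.norm_tmul_le σ ξ h).continuous

theorem Tensor.tmul_zero_left (h : H) : Tensor.tmul σ (0 : E) h = 0 := by
  rw [Tensor.tmul, TensorProduct.zero_tmul, map_zero]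

/-- `ξ ↦ ξ ⊗ h` as a bounded operator. -/
def Tensor.tmulL (h : H) : E →L[ℂ] Tensor E σ :=
  LinearMap.mkContinuous
    { toFun := fun ξ => Tensor.tmul σ ξ h
      map_add' := fun ξ ξ' => Tensor.tmul_add_left σ ξ ξ' h
      map_smul' := fun c ξ => Tensor.tmul_smul_left σ c ξ h }
    ‖h‖ fun ξ => by rw [mul_comm]; exact Tensor.norm_tmul_le σ ξ h

variable (E) in
/-- The representation `a ↦ φ(a) ⊗ I` of `A` on `E ⊗_σ H`. -/
def NDRep.induced : NDRep A (Tensor E σ) where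
  toHom :=
    { toFun := Tensor.act σ
      map_smul' := fun c a => Tensor.ext σ fun ξ h => by
        simp [Tensor.act_tmul, Tensor.tmul_smul_left]
      map_zero' := Tensor.ext σ fun ξ h => by simp [Tensor.act_tmul, Tensor.tmul_zero_left]
      map_add' := fun a b => Tensor.ext σ fun ξ h => by
        simp [Tensor.act_tmul, Tensor.tmul_add_left]
      map_mul' := fun a b => Tensor.ext σ fun ξ h => by
        simp [Tensor.act_tmul, φ_mul]
      map_star' := fun a => by
        rw [ContinuousLinearMap.star_eq_adjoint, ContinuousLinearMap.eq_adjoint_iff]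
        intro x y
        induction x using Tensor.induction with
        | hc => exact isClosed_eq (by fun_prop) (by fun_prop)
        | h0 => simp
        | ha x x' hx hx' => simp only [map_add, inner_add_left, hx, hx']
        | ht ξ h =>
          induction y using Tensor.induction with
          | hc => exact isClosed_eq (by fun_prop) (by fun_prop)
          | h0 => simp
          | ha y y' hy hy' => simp only [map_add, inner_add_right, hy, hy']
          | ht η g =>
            rw [Tensor.act_tmul, Tensor.act_tmul, Tensor.inner_tmul, Tensor.inner_tmul, ip_φ,
              star_star] }
  nondegenerate := by
    set S : Set (Tensor E σ) := {g | ∃ (a : A) (h : Tensor E σ), Tensor.act σ a h = g} with hS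
    intro x
    change x ∈ closure (Submodule.span ℂ S : Set (Tensor E σ))
    rw [← Submodule.topologicalClosure_coe]
    induction x using Tensor.induction with
    | hc => exact (Submodule.span ℂ S).isClosed_topologicalClosure
    | h0 => exact zero_mem _
    | ha x y hx hy => exact add_mem hx hy
    | ht ξ h =>
      have h1 : Set.MapsTo (Tensor.tmulL σ h)
          (Submodule.span ℂ {ζ : E | ∃ (a : A) (ξ : E), φ a ξ = ζ} : Set E)
          (Submodule.span ℂ S : Set (Tensor E σ)) := by
        intro ζ hζ
        refine Submodule.span_induction (p := fun ζ _ => Tensor.tmulL σ h ζ ∈ Submodule.span ℂ S)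
          ?_ ?_ ?_ ?_ hζ
        · rintro _ ⟨a, η, rfl⟩
          exact Submodule.subset_span ⟨a, Tensor.tmul σ η h, Tensor.act_tmul σ a η h⟩
        · rw [map_zero]; exact zero_mem _
        · intro x y _ _ hx hy; rw [map_add]; exact add_mem hx hy
        · intro c x _ hx; rw [map_smul]; exact Submodule.smul_mem _ _ hx
      have h2 := map_mem_closure (Tensor.tmulL σ h).continuous (essential (A := A) ξ) h1
      rw [← Submodule.topologicalClosure_coe] at h2
      exact h2

@[simp] theorem NDRep.induced_tmul (a : A) (ξ : E) (h : H) :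
    NDRep.induced E σ a (Tensor.tmul σ ξ h) = Tensor.tmul σ (φ a ξ) h := Tensor.act_tmul σ a ξ h

variable {σ ρ} in
theorem Intertwines.map {X : H →L[ℂ] K} (hX : Intertwines σ ρ X) :
    Intertwines (NDRep.induced E σ) (NDRep.induced E ρ) (Tensor.map E σ ρ X hX) := fun a x => by
  induction x using Tensor.induction with
  | hc => exact isClosed_eq (by fun_prop) (by fun_prop)
  | h0 => simp
  | ha x y hx hy => simp only [map_add, hx, hy]
  | ht ξ h => simp

/-- The bilinear map `m : E × F → G` induces a unitary isomorphism `ξ ⊗ η ↦ m ξ η` of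
correspondences from the interior tensor product `E ⊗_A F` onto `G`: it preserves the inner product
`⟨ξ ⊗ η, ξ' ⊗ η'⟩ = ⟨η, ⟨ξ, ξ'⟩ η'⟩`, is a bimodule map, and has dense span. -/
structure IsTensorIso (A : Type*) [NonUnitalCStarAlgebra A] [PartialOrder A] [StarOrderedRing A]
    {E : Type*} [NormedAddCommGroup E] [NormedSpace ℂ E] [CompleteSpace E] [Correspondence A E]
    {F : Type*} [NormedAddCommGroup F] [NormedSpace ℂ F] [CompleteSpace F] [Correspondence A F]
    {G : Type*} [NormedAddCommGroup G] [NormedSpace ℂ G] [CompleteSpace G] [Correspondence A G]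
    (m : E →ₗ[ℂ] F →ₗ[ℂ] G) : Prop where
  ip_eq : ∀ (ξ ξ' : E) (η η' : F), (ip (m ξ η) (m ξ' η') : A) = ip η (φ (ip ξ ξ' : A) η')
  φ_eq : ∀ (a : A) (ξ : E) (η : F), m (φ a ξ) η = φ a (m ξ η)
  rsmul_eq : ∀ (a : A) (ξ : E) (η : F), m ξ (rsmul a η) = rsmul a (m ξ η)
  dense : Dense (Submodule.span ℂ {ζ : G | ∃ (ξ : E) (η : F), m ξ η = ζ} : Set G)

theorem tensorForm_rTensor {m : E →ₗ[ℂ] F →ₗ[ℂ] G} (hm : IsTensorIso A m) (ξ ξ' : E)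
    (x y : F ⊗[ℂ] H) :
    tensorForm G σ (LinearMap.rTensor H (m ξ) x) (LinearMap.rTensor H (m ξ') y)
      = tensorForm F σ x (act F H (ip ξ ξ' : A) y) := by
  induction x with
  | zero => simp
  | add x x' hx hx' => simp [hx, hx']
  | tmul η h =>
    induction y with
    | zero => simp
    | add y y' hy hy' => simp only [map_add, hy, hy']
    | tmul η' h' =>
      rw [LinearMap.rTensor_tmul, LinearMap.rTensor_tmul, act_tmul, tensorForm_tmul,
        tensorForm_tmul, hm.ip_eq]

/-- `η ⊗ h ↦ m ξ η ⊗ h` -/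
def Tensor.creation (m : E →ₗ[ℂ] F →ₗ[ℂ] G) (ξ : E) : Tensor F σ →L[ℂ] Tensor G σ :=
  Tensor.lift σ (Tensor.ofAlg σ ∘ₗ LinearMap.rTensor H (m ξ))

theorem Tensor.creation_ofAlg {m : E →ₗ[ℂ] F →ₗ[ℂ] G} (hm : IsTensorIso A m) (ξ : E)
    (x : F ⊗[ℂ] H) : Tensor.creation σ m ξ (Tensor.ofAlg σ x)
      = Tensor.ofAlg σ (LinearMap.rTensor H (m ξ) x) := by
  refine Tensor.lift_ofAlg σ _ ‖ξ‖ (fun x => le_of_sq_le_sq ?_ (by positivity)) x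
  rw [LinearMap.comp_apply, Tensor.norm_sq_ofAlg, tensorForm_rTensor σ hm, ← Tensor.inner_ofAlg]
  calc (⟪Tensor.ofAlg σ x, Tensor.ofAlg σ (ProdSys.act F H (ip ξ ξ : A) x)⟫_ℂ).re
      ≤ ‖⟪Tensor.ofAlg σ x, Tensor.ofAlg σ (ProdSys.act F H (ip ξ ξ : A) x)⟫_ℂ‖ :=
        Complex.re_le_norm _
    _ ≤ ‖Tensor.ofAlg σ x‖ * (‖(ip ξ ξ : A)‖ * ‖Tensor.ofAlg σ x‖) :=
        (norm_inner_le_norm _ _).trans (by gcongr; exact norm_act_le σ _ x)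
    _ = (‖ξ‖ * ‖Tensor.ofAlg σ x‖) ^ 2 := by rw [mul_pow, norm_sq_eq (A := A)]; ring

theorem Tensor.creation_tmul {m : E →ₗ[ℂ] F →ₗ[ℂ] G} (hm : IsTensorIso A m) (ξ : E)
    (η : F) (h : H) :
    Tensor.creation σ m ξ (Tensor.tmul σ η h) = Tensor.tmul σ (m ξ η) h :=
  Tensor.creation_ofAlg σ hm ξ _

theorem Tensor.inner_creation {m : E →ₗ[ℂ] F →ₗ[ℂ] G} (hm : IsTensorIso A m) (ξ ξ' : E)
    (x y : Tensor F σ) :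
    ⟪Tensor.creation σ m ξ x, Tensor.creation σ m ξ' y⟫_ℂ
      = ⟪x, NDRep.induced F σ (ip ξ ξ' : A) y⟫_ℂ := by
  induction x using Tensor.induction with
  | hc => exact isClosed_eq (by fun_prop) (by fun_prop)
  | h0 => simp
  | ha x x' hx hx' => simp only [map_add, inner_add_left, hx, hx']
  | ht η h =>
    induction y using Tensor.induction with
    | hc => exact isClosed_eq (by fun_prop) (by fun_prop)
    | h0 => simp
    | ha y y' hy hy' => simp only [map_add, inner_add_right, hy, hy']
    | ht η' h' =>
      rw [Tensor.creation_tmul σ hm, Tensor.creation_tmul σ hm, NDRep.induced_tmul,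
        Tensor.inner_tmul, Tensor.inner_tmul, hm.ip_eq]

/-- `ξ ⊗ x ↦ creation ξ x` on algebraic tensors -/
def Tensor.assocAlg {m : E →ₗ[ℂ] F →ₗ[ℂ] G} (hm : IsTensorIso A m) :
    (E ⊗[ℂ] Tensor F σ) →ₗ[ℂ] Tensor G σ :=
  TensorProduct.lift (LinearMap.mk₂ ℂ (fun ξ x => Tensor.creation σ m ξ x)
    (fun ξ ξ' x => by
      rw [← add_apply]
      congr 1
      exact Tensor.ext σ fun η h => by
        simp [Tensor.creation_tmul σ hm, Tensor.tmul_add_left])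
    (fun c ξ x => by
      rw [← smul_apply]
      congr 1
      exact Tensor.ext σ fun η h => by
        simp [Tensor.creation_tmul σ hm, Tensor.tmul_smul_left])
    (fun ξ x y => map_add _ _ _) (fun c ξ x => map_smul _ _ _))

theorem Tensor.inner_assocAlg {m : E →ₗ[ℂ] F →ₗ[ℂ] G} (hm : IsTensorIso A m)
    (x y : E ⊗[ℂ] Tensor F σ) :
    ⟪Tensor.assocAlg σ hm x, Tensor.assocAlg σ hm y⟫_ℂ
      = tensorForm E (NDRep.induced F σ) x y := by
  induction x with
  | zero => simp
  | add x x' hx hx' => simp only [map_add, inner_add_left, hx, hx', LinearMap.add_apply]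
  | tmul ξ z =>
    induction y with
    | zero => simp
    | add y y' hy hy' => simp only [map_add, inner_add_right, hy, hy']
    | tmul ξ' z' => exact Tensor.inner_creation σ hm ξ ξ' z z'

theorem Tensor.norm_assocAlg {m : E →ₗ[ℂ] F →ₗ[ℂ] G} (hm : IsTensorIso A m)
    (x : E ⊗[ℂ] Tensor F σ) :
    ‖Tensor.assocAlg σ hm x‖ = ‖Tensor.ofAlg (NDRep.induced F σ) x‖ := by
  rw [← sq_eq_sq₀ (norm_nonneg _) (norm_nonneg _), Tensor.norm_sq_ofAlg, ← Tensor.inner_assocAlg σ hm,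
    ← inner_self_eq_norm_sq (𝕜 := ℂ)]
  rfl

theorem Tensor.lift_assocAlg {m : E →ₗ[ℂ] F →ₗ[ℂ] G} (hm : IsTensorIso A m)
    (x : E ⊗[ℂ] Tensor F σ) :
    Tensor.lift (NDRep.induced F σ) (Tensor.assocAlg σ hm) (Tensor.ofAlg _ x)
      = Tensor.assocAlg σ hm x :=
  Tensor.lift_ofAlg _ _ 1 (fun x => by rw [Tensor.norm_assocAlg, one_mul]) x

/-- The isometry underlying `Tensor.assoc`. -/
def Tensor.assocIsometry {m : E →ₗ[ℂ] F →ₗ[ℂ] G} (hm : IsTensorIso A m) :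
    Tensor E (NDRep.induced F σ) →ₗᵢ[ℂ] Tensor G σ where
  toLinearMap := (Tensor.lift (NDRep.induced F σ) (Tensor.assocAlg σ hm) : _ →L[ℂ] _)
  norm_map' x := by
    refine (Tensor.denseRange_ofAlg _).induction_on (p := fun x =>
      ‖Tensor.lift (NDRep.induced F σ) (Tensor.assocAlg σ hm) x‖ = ‖x‖) x
      (isClosed_eq (by fun_prop) (by fun_prop)) fun x => ?_
    rw [Tensor.lift_assocAlg, Tensor.norm_assocAlg]

theorem Tensor.assocIsometry_tmul {m : E →ₗ[ℂ] F →ₗ[ℂ] G} (hm : IsTensorIso A m)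
    (ξ : E) (η : F) (h : H) :
    Tensor.assocIsometry σ hm (Tensor.tmul _ ξ (Tensor.tmul σ η h)) = Tensor.tmul σ (m ξ η) h :=
  (Tensor.lift_assocAlg σ hm _).trans (Tensor.creation_tmul σ hm ξ η h)

theorem Tensor.assocIsometry_surjective {m : E →ₗ[ℂ] F →ₗ[ℂ] G} (hm : IsTensorIso A m) :
    Function.Surjective (Tensor.assocIsometry σ hm) := by
  intro x
  let R : Submodule ℂ (Tensor G σ) := LinearMap.range (Tensor.assocIsometry σ hm).toLinearMap
  have hR : IsClosed (R : Set (Tensor G σ)) :=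
    (Tensor.assocIsometry σ hm).isometry.isClosedEmbedding.isClosed_range
  change x ∈ R
  induction x using Tensor.induction with
  | hc => exact hR
  | h0 => exact zero_mem _
  | ha x y hx hy => exact add_mem hx hy
  | ht ζ h =>
    have h1 : Set.MapsTo (Tensor.tmulL σ h)
        (Submodule.span ℂ {ζ : G | ∃ (ξ : E) (η : F), m ξ η = ζ} : Set G) (R : Set (Tensor G σ)) := by
      intro ζ hζ
      refine Submodule.span_induction (p := fun ζ _ => Tensor.tmulL σ h ζ ∈ R) ?_ ?_ ?_ ?_ hζ
      · rintro _ ⟨ξ, η, rfl⟩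
        exact ⟨_, Tensor.assocIsometry_tmul σ hm ξ η h⟩
      · rw [map_zero]; exact zero_mem _
      · intro x y _ _ hx hy; rw [map_add]; exact add_mem hx hy
      · intro c x _ hx; rw [map_smul]; exact Submodule.smul_mem _ _ hx
    have := map_mem_closure (Tensor.tmulL σ h).continuous (hm.dense ζ) h1
    rwa [hR.closure_eq] at this

/-- The unitary `E ⊗ (F ⊗_σ H) → G ⊗_σ H`, `ξ ⊗ (η ⊗ h) ↦ m ξ η ⊗ h`, coming from the
identification of `E ⊗_A F` with `G`. -/
def Tensor.assoc {m : E →ₗ[ℂ] F →ₗ[ℂ] G} (hm : IsTensorIso A m) :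
    Tensor E (NDRep.induced F σ) ≃ₗᵢ[ℂ] Tensor G σ :=
  LinearIsometryEquiv.ofSurjective (Tensor.assocIsometry σ hm) (Tensor.assocIsometry_surjective σ hm)

@[simp] theorem Tensor.assoc_tmul {m : E →ₗ[ℂ] F →ₗ[ℂ] G} (hm : IsTensorIso A m)
    (ξ : E) (η : F) (h : H) :
    Tensor.assoc σ hm (Tensor.tmul _ ξ (Tensor.tmul σ η h)) = Tensor.tmul σ (m ξ η) h :=
  Tensor.assocIsometry_tmul σ hm ξ η h

theorem Tensor.assoc_intertwines {m : E →ₗ[ℂ] F →ₗ[ℂ] G} (hm : IsTensorIso A m) :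
    Intertwines (NDRep.induced E (NDRep.induced F σ)) (NDRep.induced G σ)
      (Tensor.assoc σ hm).toContinuousLinearEquiv.toContinuousLinearMap := fun a x => by
  change Tensor.assoc σ hm _ = NDRep.induced G σ a (Tensor.assoc σ hm x)
  induction x using Tensor.induction with
  | hc => exact isClosed_eq (by fun_prop) (by fun_prop)
  | h0 => simp
  | ha x y hx hy => simp only [map_add, hx, hy]
  | ht ξ z =>
    induction z using Tensor.induction with
    | hc =>
      have h1 : Continuous fun z : Tensor F σ => Tensor.tmul (NDRep.induced F σ) ξ z :=
        (Tensor.continuous_tmul_right _ ξ)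
      exact isClosed_eq (by fun_prop) (by fun_prop)
    | h0 => simp [Tensor.tmul]
    | ha x y hx hy => simp only [Tensor.tmul_add_right, map_add, hx, hy]
    | ht η h => simp [hm.φ_eq]

theorem Tensor.assoc_symm_intertwines {m : E →ₗ[ℂ] F →ₗ[ℂ] G} (hm : IsTensorIso A m) :
    Intertwines (NDRep.induced G σ) (NDRep.induced E (NDRep.induced F σ))
      (Tensor.assoc σ hm).symm.toContinuousLinearEquiv.toContinuousLinearMap := fun a x => by
  change (Tensor.assoc σ hm).symm _ = NDRep.induced E (NDRep.induced F σ) a ((Tensor.assoc σ hm).symm x)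
  rw [LinearIsometryEquiv.symm_apply_eq]
  have := Tensor.assoc_intertwines σ hm a ((Tensor.assoc σ hm).symm x)
  change Tensor.assoc σ hm _ = NDRep.induced G σ a (Tensor.assoc σ hm ((Tensor.assoc σ hm).symm x)) at this
  rw [this, LinearIsometryEquiv.apply_symm_apply]

end operators

section covariant

open Correspondence

variable {A : Type*} [NonUnitalCStarAlgebra A] [PartialOrder A] [StarOrderedRing A]
variable {E : Type*} [NormedAddCommGroup E] [NormedSpace ℂ E] [CompleteSpace E]
  [Correspondence A E]
variable {H : Type*} [NormedAddCommGroup H] [InnerProductSpace ℂ H] [CompleteSpace H]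
variable (σ : NDRep A H) (T : E →ₗ[ℂ] (H →L[ℂ] H))

/-- `(σ, T)` is a completely contractive covariant representation of `E` on `H`. Here the norm of
`(ξ i j) ∈ M_n(E)` is `‖(∑ k, ⟨ξ k i, ξ k j⟩)_{i, j}‖ ^ (1 / 2)`, the norm being that of the
`C⋆`-algebra `M_n(A)`, and `M_n(B(H))` is normed as `B(H ⊕ ⋯ ⊕ H)`. -/
structure IsCovariantRep : Prop where
  completely_contractive : ∀ (n : ℕ) (ξ : Fin n → Fin n → E) (h : Fin n → H),
    ∑ i, ‖∑ j, T (ξ i j) (h j)‖ ^ 2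
      ≤ ‖CStarMatrix.ofMatrix (Matrix.of fun i j => ∑ l, (ip (ξ l i) (ξ l j) : A))‖
        * ∑ j, ‖h j‖ ^ 2
  covariant : ∀ (a b : A) (ξ : E), T (φ a (rsmul b ξ)) = σ a ∘L T ξ ∘L σ b

variable {σ T}

theorem NDRep.ext_right {W : Type*} [NormedAddCommGroup W] [NormedSpace ℂ W] {X Y : H →L[ℂ] W}
    (h : ∀ (a : A) (x : H), X (σ a x) = Y (σ a x)) : X = Y := by
  refine ContinuousLinearMap.ext_on σ.nondegenerate ?_
  rintro _ ⟨a, x, rfl⟩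
  exact h a x

theorem NDRep.ext_left {x y : H} (h : ∀ a : A, σ a x = σ a y) : x = y := by
  have : innerSL ℂ x = innerSL ℂ y := NDRep.ext_right (σ := σ) fun a z => by
    rw [innerSL_apply_apply, innerSL_apply_apply, ← ContinuousLinearMap.adjoint_inner_left,
      ← ContinuousLinearMap.adjoint_inner_left, ← ContinuousLinearMap.star_eq_adjoint,
      ← map_star, h]
  refine ext_inner_right ℂ fun z => ?_
  simpa using congrFun (congrArg DFunLike.coe this) z

theorem φ_rsmul (a b : A) (ξ : E) : (φ a (rsmul b ξ) : E) = rsmul b (φ a ξ) := by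
  have h1 : ∀ ζ : E, (ip ζ (φ a (rsmul b ξ) - rsmul b (φ a ξ)) : A) = 0 := fun ζ => by
    have h2 : ∀ η : E, (ip ζ (φ a η) : A) = ip (φ (star a) ζ) η := fun η => by
      rw [ip_φ, star_star]
    rw [ip_sub_right, h2, ip_rsmul_right, ip_rsmul_right, h2, sub_self]
  have h3 := norm_sq_eq (A := A) (φ a (rsmul b ξ) - rsmul b (φ a ξ) : E)
  rw [h1, norm_zero] at h3
  exact sub_eq_zero.mp (norm_eq_zero.mp (pow_eq_zero_iff (two_ne_zero) |>.mp h3))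

theorem IsCovariantRep.map_rsmul (hT : IsCovariantRep σ T) (b : A) (ξ : E) :
    T (rsmul b ξ) = T ξ ∘L σ b := by
  refine NDRep.ext_right (σ := σ) fun c x => NDRep.ext_left (σ := σ) fun a => ?_
  have h1 := hT.covariant a c (rsmul b ξ)
  rw [← rsmul_mul, hT.covariant] at h1
  have h2 := congrFun (congrArg DFunLike.coe h1) x
  simp only [ContinuousLinearMap.comp_apply, map_mul, mul_apply_eq_comp] at h2 ⊢
  exact h2.symm

theorem IsCovariantRep.map_φ (hT : IsCovariantRep σ T) (a : A) (ξ : E) :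
    T (φ a ξ) = σ a ∘L T ξ := by
  refine NDRep.ext_right (σ := σ) fun b x => ?_
  have h1 := hT.covariant a b ξ
  rw [φ_rsmul, hT.map_rsmul] at h1
  exact congrFun (congrArg DFunLike.coe h1) x

theorem IsCovariantRep.norm_row_sq_le (hT : IsCovariantRep σ T) {n : ℕ} (ξ : Fin n → E)
    (h : Fin n → H) : ‖∑ j, T (ξ j) (h j)‖ ^ 2 ≤ ‖gram A ξ‖ * ∑ j, ‖h j‖ ^ 2 := by
  rcases n with _ | n
  · simp
  · have h1 := hT.completely_contractive (n + 1) (fun i => if i = 0 then ξ else 0) h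
    have h2 : (CStarMatrix.ofMatrix (Matrix.of fun i j : Fin (n + 1) =>
        ∑ l : Fin (n + 1), (ip ((if l = 0 then ξ else 0 : Fin (n + 1) → E) i)
          ((if l = 0 then ξ else 0 : Fin (n + 1) → E) j) : A))) = gram A ξ := by
      unfold gram
      congr 2
      ext i j
      rw [Finset.sum_eq_single 0]
      · simp
      · intro l _ hl
        simp only [hl, if_false, Pi.zero_apply]
        exact map_zero (ipₛₗ A (0 : E))
      · simp
    rw [h2] at h1
    refine le_trans ?_ h1
    refine le_trans (le_of_eq ?_) (Finset.single_le_sum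
      (f := fun i : Fin (n + 1) => ‖∑ j, T ((if i = 0 then ξ else 0 : Fin (n + 1) → E) j) (h j)‖ ^ 2)
      (fun i _ => by positivity) (Finset.mem_univ 0))
    simp

theorem IsCovariantRep.sum_rowMul (hT : IsCovariantRep σ T) {n : ℕ} (ξ : Fin n → E)
    (B : CStarMatrix (Fin n) (Fin n) A) (h : Fin n → H) :
    ∑ j, T (rowMul ξ B j) (h j) = ∑ l, T (ξ l) (∑ j, σ (B l j) (h j)) := by
  simp only [rowMul, map_sum, hT.map_rsmul, _root_.sum_apply, ContinuousLinearMap.comp_apply]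
  exact Finset.sum_comm

/-- `‖∑ T(ξ i) h i‖ ≤ ‖∑ ξ i ⊗ h i‖` -/
theorem IsCovariantRep.norm_sum_le (hT : IsCovariantRep σ T) {n : ℕ} (ξ : Fin n → E)
    (h : Fin n → H) :
    ‖∑ j, T (ξ j) (h j)‖ ≤ ‖Tensor.ofAlg σ (∑ i, ξ i ⊗ₜ[ℂ] h i)‖ := by
  obtain ⟨D, hD⟩ := exists_gram_sqrt (A := A) ξ
  set Q := ‖Tensor.ofAlg σ (∑ i, ξ i ⊗ₜ[ℂ] h i)‖ with hQ
  set S := ∑ j, ‖h j‖ ^ 2 with hS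
  have hS0 : 0 ≤ S := Finset.sum_nonneg fun j _ => by positivity
  have key : ∀ ε : ℝ, 0 < ε → ‖∑ j, T (ξ j) (h j)‖ ≤ Q + √(ε * S) := by
    intro ε hε
    obtain ⟨b, c, hc, hb, he⟩ := exists_approx_factor (M := CStarMatrix (Fin n) (Fin n) A) D ε hε
    rw [← hD, ← gram_rowMul] at hb
    rw [← hD, ← gram_sub_rowMul] at he
    have h1 : ‖∑ j, T (ξ j - rowMul ξ (b * c) j) (h j)‖ ≤ √(ε * S) := by
      refine Real.le_sqrt_of_sq_le ((hT.norm_row_sq_le _ h).trans ?_)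
      gcongr
    have h2 : ‖∑ j, T (rowMul ξ (b * c) j) (h j)‖ ≤ Q := by
      have h3 : ∑ j, T (rowMul ξ (b * c) j) (h j)
          = ∑ l, T (rowMul ξ b l) (∑ j, σ (c l j) (h j)) := by
        rw [hT.sum_rowMul, hT.sum_rowMul]
        refine Finset.sum_congr rfl fun l _ => ?_
        congr 1
        have : ∀ j, (b * c) l j = ∑ i, b l i * c i j := fun j => by
          rw [CStarMatrix.mul_apply]
        simp only [this, map_sum, map_mul, _root_.sum_apply, mul_apply_eq_comp]
        exact Finset.sum_comm
      rw [h3]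
      refine le_of_sq_le_sq ((hT.norm_row_sq_le _ _).trans ?_) (norm_nonneg _)
      rw [hQ, Tensor.norm_sq_sum σ ξ h c (hD.trans hc.symm)]
      refine (mul_le_mul_of_nonneg_right hb (Finset.sum_nonneg fun j _ => by positivity)).trans ?_
      rw [one_mul]
    have h4 : ∑ j, T (ξ j) (h j)
        = ∑ j, T (rowMul ξ (b * c) j) (h j) + ∑ j, T (ξ j - rowMul ξ (b * c) j) (h j) := by
      rw [← Finset.sum_add_distrib]
      refine Finset.sum_congr rfl fun j _ => ?_
      rw [map_sub, sub_apply]; abel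
    rw [h4]
    exact (norm_add_le _ _).trans (add_le_add h2 h1)
  refine le_of_forall_pos_le_add fun δ hδ => (key (δ ^ 2 / (S + 1)) (by positivity)).trans ?_
  gcongr
  refine Real.sqrt_le_iff.mpr ⟨hδ.le, ?_⟩
  rw [div_mul_eq_mul_div, div_le_iff₀ (by positivity)]
  nlinarith [sq_nonneg δ]

variable (T)

/-- `ξ ⊗ h ↦ T(ξ) h` on algebraic tensors -/
def tildeAlg : (E ⊗[ℂ] H) →ₗ[ℂ] H :=
  TensorProduct.lift ((ContinuousLinearMap.coeLM ℂ) ∘ₗ T)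

theorem tildeAlg_tmul (ξ : E) (h : H) : tildeAlg T (ξ ⊗ₜ h) = T ξ h := rfl

variable (σ)

/-- The operator `T̃ : E ⊗_σ H → H`, `ξ ⊗ h ↦ T(ξ) h`, bounded when `(σ, T)` is a completely
contractive covariant representation. -/
def tilde : Tensor E σ →L[ℂ] H := Tensor.lift σ (tildeAlg T)

variable {σ T}

theorem IsCovariantRep.tilde_ofAlg (hT : IsCovariantRep σ T) (x : E ⊗[ℂ] H) :
    tilde σ T (Tensor.ofAlg σ x) = tildeAlg T x := by
  refine Tensor.lift_ofAlg σ _ 1 (fun x => ?_) x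
  obtain ⟨n, ξ, h, rfl⟩ := exists_sum_tmul x
  rw [one_mul, map_sum]
  exact hT.norm_sum_le ξ h

theorem IsCovariantRep.tilde_tmul (hT : IsCovariantRep σ T) (ξ : E) (h : H) :
    tilde σ T (Tensor.tmul σ ξ h) = T ξ h := hT.tilde_ofAlg _

theorem IsCovariantRep.norm_tilde_le (hT : IsCovariantRep σ T) : ‖tilde σ T‖ ≤ 1 := by
  refine ContinuousLinearMap.opNorm_le_bound _ zero_le_one fun x => ?_
  refine (Tensor.denseRange_ofAlg σ).induction_on (p := fun x => ‖tilde σ T x‖ ≤ 1 * ‖x‖) x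
    (isClosed_le (by fun_prop) (by fun_prop)) fun x => ?_
  obtain ⟨n, ξ, h, rfl⟩ := exists_sum_tmul x
  rw [one_mul, hT.tilde_ofAlg, map_sum]
  exact hT.norm_sum_le ξ h

theorem IsCovariantRep.tilde_intertwines (hT : IsCovariantRep σ T) :
    Intertwines (NDRep.induced E σ) σ (tilde σ T) := fun a x => by
  induction x using Tensor.induction with
  | hc => exact isClosed_eq (by fun_prop) (by fun_prop)
  | h0 => simp
  | ha x y hx hy => simp only [map_add, hx, hy]
  | ht ξ h => rw [NDRep.induced_tmul, hT.tilde_tmul, hT.tilde_tmul, hT.map_φ]; rfl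

/-- `T̃` is also defined (and isometric) when `T(ξ)⋆ T(η) = σ(⟨ξ, η⟩)`. -/
theorem tilde_tmul_of_isometric
    (hT : ∀ ξ η : E, ContinuousLinearMap.adjoint (T ξ) ∘L T η = σ (ip ξ η)) (ξ : E) (h : H) :
    tilde σ T (Tensor.tmul σ ξ h) = T ξ h := by
  have key : ∀ x y : E ⊗[ℂ] H, ⟪tildeAlg T x, tildeAlg T y⟫_ℂ = tensorForm E σ x y := by
    intro x y
    induction x with
    | zero => simp
    | add x x' hx hx' => simp only [map_add, inner_add_left, hx, hx', LinearMap.add_apply]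
    | tmul ξ h =>
      induction y with
      | zero => simp
      | add y y' hy hy' => simp only [map_add, inner_add_right, hy, hy']
      | tmul η g =>
        rw [tildeAlg_tmul, tildeAlg_tmul, tensorForm_tmul, ← hT,
          ← ContinuousLinearMap.adjoint_inner_right]
        rfl
  refine Tensor.lift_ofAlg σ _ 1 (fun x => ?_) _
  rw [one_mul]
  refine le_of_sq_le_sq ?_ (norm_nonneg _)
  rw [Tensor.norm_sq_ofAlg, ← key, ← inner_self_eq_norm_sq (𝕜 := ℂ)]
  rfl

end covariant

section productSystem

open Correspondence

/-- A product system of `C⋆`-correspondences over `ℕ^k`: correspondences `E n` over `A` with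
`E 0 = A` and associative multiplications `E m × E n → E (m + n)` which induce isomorphisms
`E m ⊗_A E n ≅ E (m + n)` of correspondences and which are the module actions if `m = 0` or
`n = 0`. -/
structure ProductSystem (A : Type*) [NonUnitalCStarAlgebra A] [PartialOrder A]
    [StarOrderedRing A] (k : ℕ) where
  E : (Fin k → ℕ) → Type*
  [group : ∀ n, NormedAddCommGroup (E n)]
  [space : ∀ n, NormedSpace ℂ (E n)]
  [complete : ∀ n, CompleteSpace (E n)]
  [corr : ∀ n, Correspondence A (E n)]
  /-- the identification of `A` with `E 0` -/
  one : A ≃ₗ[ℂ] E 0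
  ip_one : ∀ a b : A, (ip (one a) (one b) : A) = star a * b
  φ_one : ∀ a b : A, φ a (one b) = one (a * b)
  rsmul_one : ∀ a b : A, rsmul a (one b) = one (b * a)
  mul : ∀ {m n p : Fin k → ℕ}, m + n = p → E m →ₗ[ℂ] E n →ₗ[ℂ] E p
  mul_iso : ∀ {m n p : Fin k → ℕ} (h : m + n = p), IsTensorIso A (mul h)
  mul_assoc : ∀ {m n p mn np q : Fin k → ℕ} (h₁ : m + n = mn) (h₂ : mn + p = q) (h₃ : n + p = np)
    (h₄ : m + np = q) (ξ : E m) (η : E n) (ζ : E p),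
    mul h₂ (mul h₁ ξ η) ζ = mul h₄ ξ (mul h₃ η ζ)
  one_mul : ∀ {n : Fin k → ℕ} (a : A) (ξ : E n), mul (zero_add n) (one a) ξ = φ a ξ
  mul_one : ∀ {n : Fin k → ℕ} (a : A) (ξ : E n), mul (add_zero n) ξ (one a) = rsmul a ξ

attribute [instance] ProductSystem.group ProductSystem.space ProductSystem.complete
  ProductSystem.corr

variable {A : Type*} [NonUnitalCStarAlgebra A] [PartialOrder A] [StarOrderedRing A] {k : ℕ}

/-- The basis element `e i` of `ℕ^k`. -/
def e (i : Fin k) : Fin k → ℕ := Pi.single i 1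

variable (X : ProductSystem A k)

variable {H : Type*} [NormedAddCommGroup H] [InnerProductSpace ℂ H] [CompleteSpace H]

/-- The unitary `E m ⊗ E n ⊗ H → E p ⊗ H` for `p = m + n`. -/
def ProductSystem.unit (σ : NDRep A H) {m n p : Fin k → ℕ} (h : m + n = p) :
    Tensor (X.E m) (NDRep.induced (X.E n) σ) ≃ₗᵢ[ℂ] Tensor (X.E p) σ :=
  Tensor.assoc σ (X.mul_iso h)

@[simp] theorem ProductSystem.unit_tmul (σ : NDRep A H) {m n p : Fin k → ℕ} (hp : m + n = p)
    (ξ : X.E m) (η : X.E n) (h : H) :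
    X.unit σ hp (Tensor.tmul _ ξ (Tensor.tmul σ η h)) = Tensor.tmul σ (X.mul hp ξ η) h :=
  Tensor.assoc_tmul σ (X.mul_iso hp) ξ η h

theorem ProductSystem.unit_symm_intertwines (σ : NDRep A H) {m n p : Fin k → ℕ} (h : m + n = p) :
    Intertwines (NDRep.induced (X.E p) σ) (NDRep.induced (X.E m) (NDRep.induced (X.E n) σ))
      (X.unit σ h).symm.toContinuousLinearEquiv.toContinuousLinearMap :=
  Tensor.assoc_symm_intertwines σ (X.mul_iso h)

/-- The unitary `E m ⊗ E n ⊗ H → E m' ⊗ E n' ⊗ H` for `m + n = m' + n'`, obtained by identifying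
both `E m ⊗ E n` and `E m' ⊗ E n'` with `E (m + n)`. -/
def ProductSystem.swap (σ : NDRep A H) {m n m' n' p : Fin k → ℕ} (h : m + n = p)
    (h' : m' + n' = p) :
    Tensor (X.E m) (NDRep.induced (X.E n) σ) ≃ₗᵢ[ℂ] Tensor (X.E m') (NDRep.induced (X.E n') σ) :=
  (X.unit σ h).trans (X.unit σ h').symm

/-- `t_{i, j} ⊗ I_H : E_i ⊗ E_j ⊗ H → E_j ⊗ E_i ⊗ H`, where `t_{i, j} : E_i ⊗ E_j → E_j ⊗ E_i` is
the isomorphism obtained by identifying both sides with `E (e i + e j)`. -/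
def ProductSystem.flip (σ : NDRep A H) (i j : Fin k) :
    Tensor (X.E (e i)) (NDRep.induced (X.E (e j)) σ) ≃ₗᵢ[ℂ]
      Tensor (X.E (e j)) (NDRep.induced (X.E (e i)) σ) :=
  X.swap σ (m := e i) (n := e j) (m' := e j) (n' := e i) (p := e i + e j) rfl (add_comm _ _)

/-- A completely contractive covariant representation `(σ, T^{(1)}, …, T^{(k)})` of the product
system `X` on `H`. -/
structure Rep (X : ProductSystem A k) (H : Type*) [NormedAddCommGroup H] [InnerProductSpace ℂ H]
    [CompleteSpace H] where
  σ : NDRep A H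
  T : ∀ i, X.E (e i) →ₗ[ℂ] (H →L[ℂ] H)
  isRep : ∀ i, IsCovariantRep σ (T i)
  /-- `T̃ⁱ (I ⊗ T̃ʲ) = T̃ʲ (I ⊗ T̃ⁱ) (t_{i, j} ⊗ I)` -/
  comm : ∀ i j, tilde σ (T i) ∘L Tensor.map (X.E (e i)) _ _ (tilde σ (T j)) (isRep j).tilde_intertwines
    = tilde σ (T j) ∘L Tensor.map (X.E (e j)) _ _ (tilde σ (T i)) (isRep i).tilde_intertwines
      ∘L (X.flip σ i j).toContinuousLinearEquiv.toContinuousLinearMap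

namespace Rep

open ContinuousLinearMap (adjoint)

variable {X}
variable (R : Rep X H)

/-- `T̃ⁱ : E_i ⊗_σ H → H` -/
abbrev tilde (i : Fin k) : Tensor (X.E (e i)) R.σ →L[ℂ] H := ProdSys.tilde R.σ (R.T i)

theorem tilde_intertwines (i : Fin k) :
    Intertwines (NDRep.induced (X.E (e i)) R.σ) R.σ (R.tilde i) := (R.isRep i).tilde_intertwines

/-- `T^{(i)}(ξ)⋆ T^{(i)}(η) = σ(⟨ξ, η⟩)` for all `i` -/
def Isometric : Prop :=
  ∀ (i : Fin k) (ξ η : X.E (e i)), adjoint (R.T i ξ) ∘L R.T i η = R.σ (ip ξ η)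

/-- `T̃ⁱ T̃ⁱ⋆ = I_H` for all `i` -/
def FullyCoisometric : Prop :=
  ∀ i : Fin k, R.tilde i ∘L adjoint (R.tilde i) = ContinuousLinearMap.id ℂ H

/-- `T̃ʲ⋆ T̃ⁱ = (I ⊗ T̃ⁱ) (t_{i, j} ⊗ I) (I ⊗ T̃ʲ⋆)` for all `i ≠ j` -/
def DoublyCommuting : Prop :=
  ∀ i j : Fin k, i ≠ j →
    adjoint (R.tilde j) ∘L R.tilde i =
      Tensor.map (X.E (e j)) _ _ (R.tilde i) (R.tilde_intertwines i)
        ∘L (X.flip R.σ i j).toContinuousLinearEquiv.toContinuousLinearMap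
        ∘L Tensor.map (X.E (e i)) _ _ (adjoint (R.tilde j)) (R.tilde_intertwines j).adjoint

end Rep

/-- The degree `∑ e i` of a word in the indices `1, …, k`. -/
def degree : List (Fin k) → (Fin k → ℕ)
  | [] => 0
  | i :: w => e i + degree w

/-- The word `1 ⋯ 1 2 ⋯ 2 ⋯ k ⋯ k` of degree `n`. -/
def word (n : Fin k → ℕ) : List (Fin k) :=
  (List.finRange k).flatMap fun i => List.replicate (n i) i

theorem degree_append (v w : List (Fin k)) : degree (v ++ w) = degree v + degree w := by
  induction v with
  | nil => simp [degree]
  | cons i v ih => simp [degree, ih, add_assoc]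

theorem degree_replicate (m : ℕ) (i : Fin k) : degree (List.replicate m i) = Pi.single i m := by
  induction m with
  | zero => simp [degree]
  | succ m ih => rw [List.replicate_succ, degree, ih, e, ← Pi.single_add, add_comm]

theorem degree_word (n : Fin k → ℕ) : degree (word n) = n := by
  have h : ∀ l : List (Fin k), degree (l.flatMap fun i => List.replicate (n i) i)
      = (l.map fun i => Pi.single i (n i)).sum := fun l => by
    induction l with
    | nil => simp [degree]
    | cons i l ih => rw [List.flatMap_cons, degree_append, ih, degree_replicate]; simp
  rw [word, h, ← Fin.sum_univ_def]
  exact Finset.univ_sum_single n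

/-- `T(0) : E 0 = A → B(H)`, i.e. `σ`. -/
def ProductSystem.zeroMap (σ : NDRep A H) : X.E 0 →ₗ[ℂ] (H →L[ℂ] H) where
  toFun ξ := σ (X.one.symm ξ)
  map_add' := by simp
  map_smul' := by simp

theorem ProductSystem.zeroMap_one (σ : NDRep A H) (a : A) : X.zeroMap σ (X.one a) = σ a :=
  congrArg σ.toHom (X.one.symm_apply_apply a)

theorem tilde_zero_isometric (σ : NDRep A H) (ξ η : X.E 0) :
    ContinuousLinearMap.adjoint (X.zeroMap σ ξ) ∘L X.zeroMap σ η = σ (ip ξ η) := by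
  obtain ⟨a, rfl⟩ := X.one.surjective ξ
  obtain ⟨b, rfl⟩ := X.one.surjective η
  rw [X.ip_one, map_mul, map_star, X.zeroMap_one, X.zeroMap_one]
  rfl

theorem tilde_zero_tmul (σ : NDRep A H) (a : A) (h : H) :
    tilde σ (X.zeroMap σ) (Tensor.tmul σ (X.one a) h) = σ a h := by
  rw [tilde_tmul_of_isometric (tilde_zero_isometric X σ), X.zeroMap_one]

theorem tilde_zero_intertwines (σ : NDRep A H) :
    Intertwines (NDRep.induced (X.E 0) σ) σ (tilde σ (X.zeroMap σ)) := fun a x => by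
  induction x using Tensor.induction with
  | hc => exact isClosed_eq (by fun_prop) (by fun_prop)
  | h0 => simp
  | ha x y hx hy => simp only [map_add, hx, hy]
  | ht ξ h =>
    obtain ⟨b, rfl⟩ := X.one.surjective ξ
    rw [NDRep.induced_tmul, X.φ_one, tilde_zero_tmul, tilde_zero_tmul, map_mul]
    rfl

namespace Rep

open ContinuousLinearMap (adjoint)

variable {X}

/-- For a word `w = i₁ ⋯ i_r` of degree `p`, the operator
`E p ⊗_σ H → H`, `ξ₁ ⋯ ξ_r ⊗ h ↦ T^{(i₁)}(ξ₁) ⋯ T^{(i_r)}(ξ_r) h`, together with its covariance;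
recursively `T̃_{i w} = T̃ⁱ (I ⊗ T̃_w)` on `E (e i) ⊗ E (degree w) ⊗ H = E p ⊗ H`. -/
def tildeWord (R : Rep X H) : ∀ (w : List (Fin k)) (p : Fin k → ℕ), degree w = p →
    {W : Tensor (X.E p) R.σ →L[ℂ] H // Intertwines (NDRep.induced (X.E p) R.σ) R.σ W}
  | [], _, rfl => ⟨ProdSys.tilde R.σ (X.zeroMap R.σ), tilde_zero_intertwines X R.σ⟩
  | i :: w, _, h =>
    ⟨R.tilde i ∘L Tensor.map (X.E (e i)) _ _ (R.tildeWord w _ rfl).1 (R.tildeWord w _ rfl).2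
        ∘L (X.unit R.σ h).symm.toContinuousLinearEquiv.toContinuousLinearMap,
      (R.tilde_intertwines i).comp ((R.tildeWord w _ rfl).2.map.comp
        (X.unit_symm_intertwines R.σ h))⟩

/-- `T̃(n) : E n ⊗_σ H → H` for `n ∈ ℕ^k`, where `E n = E_1^{⊗ n₁} ⊗ ⋯ ⊗ E_k^{⊗ n_k}`. -/
def tildeAt (R : Rep X H) (n : Fin k → ℕ) : Tensor (X.E n) R.σ →L[ℂ] H :=
  (R.tildeWord (word n) n (degree_word n)).1

variable {K : Type*} [NormedAddCommGroup K] [InnerProductSpace ℂ K] [CompleteSpace K]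

/-- The representation `S` of `X` on `K` is a minimal (regular) isometric dilation of the
representation `R` on `H`, where `H` is regarded as a subspace of `K` through `ι`. -/
structure IsMinimalIsometricDilation (R : Rep X H) (S : Rep X K) (ι : H →ₗᵢ[ℂ] K) : Prop where
  isometric : S.Isometric
  /-- `H` reduces `S.σ`, which restricts to `R.σ` -/
  restrict : Intertwines R.σ S.σ ι.toContinuousLinearMap
  /-- all `V^{(i)}(ξ)⋆` leave `H` invariant -/
  coinvariant : ∀ (i : Fin k) (ξ : X.E (e i)) (h : H), ∃ h' : H, adjoint (S.T i ξ) (ι h) = ι h'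
  /-- `(I ⊗ P_H) Ṽ(m)⋆ Ṽ(n) = T̃(m)⋆ T̃(n)` on `E n ⊗ H` whenever `m ∧ n = 0` -/
  regular : ∀ m n : Fin k → ℕ, (∀ i, m i = 0 ∨ n i = 0) →
    adjoint (Tensor.map (X.E m) _ _ ι.toContinuousLinearMap restrict) ∘L adjoint (S.tildeAt m)
        ∘L S.tildeAt n ∘L Tensor.map (X.E n) _ _ ι.toContinuousLinearMap restrict
      = adjoint (R.tildeAt m) ∘L R.tildeAt n
  /-- the only closed subspace of `K` which contains `H` and is invariant under all `V^{(i)}(ξ)`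
  is `K` -/
  minimal : ∀ M : Submodule ℂ K, IsClosed (M : Set K) → (∀ h, ι h ∈ M) →
    (∀ (i : Fin k) (ξ : X.E (e i)), ∀ x ∈ M, S.T i ξ x ∈ M) → M = ⊤

end Rep

end productSystem

end

end ProdSys

/-!
For a minimal isometric dilation `S` of `R`, write `V` and `T` for the operators `S.tilde i` and
`R.tilde i`. Since `H` is invariant under all `S.T i ξ⋆`, and since regularity in the degrees `0`
and `e i` says that `S.T i ξ` compresses to `R.T i ξ`, one has `V⋆ ι = (I ⊗ ι) T⋆`
(`adjoint_tilde_comp_embedding`). Hence `T T⋆ = ι⋆ V V⋆ ι`, and `V V⋆ = I` implies `T T⋆ = I`.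

Conversely, if `T T⋆ = I`, then `‖V⋆ ι h‖ = ‖ι h‖` for all `h`, so that the vectors fixed by `V V⋆`,
which form the range of the isometry `V`, contain `H`. By the commutation relation
`S.T j ξ (V x) = V ((I ⊗ S.tilde j) (t (ξ ⊗ x)))`, with `t` the flip `E_j ⊗ E_i → E_i ⊗ E_j`, this
range is invariant under all `S.T j ξ`, and by minimality it is all of `K`.
-/

namespace ProdSys

noncomputable section

open Correspondence
open ContinuousLinearMap (adjoint)

section operators

variable {A : Type*} [NonUnitalCStarAlgebra A] [PartialOrder A] [StarOrderedRing A]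
variable {E : Type*} [NormedAddCommGroup E] [NormedSpace ℂ E] [CompleteSpace E]
  [Correspondence A E]
variable {H : Type*} [NormedAddCommGroup H] [InnerProductSpace ℂ H] [CompleteSpace H]
variable {K : Type*} [NormedAddCommGroup K] [InnerProductSpace ℂ K] [CompleteSpace K]

/-- If a contraction `V` satisfies `‖V⋆ x‖ = ‖x‖`, then `V V⋆ x = x`. -/
theorem apply_adjoint_eq_self_of_norm_eq {V : H →L[ℂ] K} (hV : ‖V‖ ≤ 1) {x : K}
    (hx : ‖adjoint V x‖ = ‖x‖) : V (adjoint V x) = x := by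
  have h1 := norm_sub_sq (𝕜 := ℂ) (V (adjoint V x)) x
  have h2 : RCLike.re ⟪V (adjoint V x), x⟫_ℂ = ‖adjoint V x‖ ^ 2 := by
    rw [← ContinuousLinearMap.adjoint_inner_right, inner_self_eq_norm_sq]
  have h3 : ‖V (adjoint V x)‖ ≤ ‖adjoint V x‖ := by
    simpa using V.le_of_opNorm_le hV (adjoint V x)
  have h4 : ‖V (adjoint V x) - x‖ ^ 2 ≤ 0 := by
    rw [h1, h2, hx]
    rw [hx] at h3
    nlinarith [norm_nonneg (V (adjoint V x))]
  exact sub_eq_zero.mp (norm_eq_zero.mp (pow_eq_zero_iff two_ne_zero |>.mp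
    (le_antisymm h4 (by positivity))))

variable {σ : NDRep A H} {ρ : NDRep A K}

theorem Tensor.ext_inner_tmul {x y : Tensor E σ}
    (h : ∀ (ξ : E) (g : H), ⟪Tensor.tmul σ ξ g, x⟫_ℂ = ⟪Tensor.tmul σ ξ g, y⟫_ℂ) : x = y := by
  refine ext_inner_left ℂ fun z => ?_
  induction z using Tensor.induction with
  | hc => exact isClosed_eq (by fun_prop) (by fun_prop)
  | h0 => simp
  | ha x y hx hy => simp only [inner_add_left, hx, hy]
  | ht ξ g => exact h ξ g

theorem Tensor.adjoint_map (Y : H →L[ℂ] K) (hY : Intertwines σ ρ Y) :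
    adjoint (Tensor.map E σ ρ Y hY) = Tensor.map E ρ σ (adjoint Y) hY.adjoint :=
  Tensor.ext ρ fun η k => Tensor.ext_inner_tmul fun ξ h => by
    rw [ContinuousLinearMap.adjoint_inner_right, Tensor.map_tmul, Tensor.map_tmul,
      Tensor.inner_tmul, Tensor.inner_tmul, ← hY.adjoint,
      ContinuousLinearMap.adjoint_inner_right]

theorem Tensor.adjoint_map_comp_map (ι : H →ₗᵢ[ℂ] K)
    (hι : Intertwines σ ρ ι.toContinuousLinearMap) :
    adjoint (Tensor.map E σ ρ ι.toContinuousLinearMap hι)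
        ∘L Tensor.map E σ ρ ι.toContinuousLinearMap hι = ContinuousLinearMap.id ℂ _ :=
  Tensor.ext σ fun η h => Tensor.ext_inner_tmul fun ξ g => by
    rw [ContinuousLinearMap.comp_apply, ContinuousLinearMap.adjoint_inner_right, Tensor.map_tmul,
      Tensor.map_tmul, Tensor.inner_tmul, ← hι, ContinuousLinearMap.id_apply, Tensor.inner_tmul]
    exact ι.inner_map_map _ _

theorem IsCovariantRep.adjoint_tilde_comp_tilde {T : E →ₗ[ℂ] (H →L[ℂ] H)}
    (hT : IsCovariantRep σ T) (hi : ∀ ξ η : E, adjoint (T ξ) ∘L T η = σ (ip ξ η)) :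
    adjoint (tilde σ T) ∘L tilde σ T = ContinuousLinearMap.id ℂ _ :=
  Tensor.ext σ fun η h => Tensor.ext_inner_tmul fun ξ g => by
    rw [ContinuousLinearMap.comp_apply, ContinuousLinearMap.adjoint_inner_right, hT.tilde_tmul,
      hT.tilde_tmul, ContinuousLinearMap.id_apply, Tensor.inner_tmul, ← hi,
      ContinuousLinearMap.comp_apply, ContinuousLinearMap.adjoint_inner_right]

end operators

section words

variable {k : ℕ}

theorem word_zero : word (0 : Fin k → ℕ) = [] := by
  simp [word]

theorem word_e (i : Fin k) : word (e i) = [i] := by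
  have h : ∀ l : List (Fin k), l.Nodup →
      (l.flatMap fun j => List.replicate (e i j) j) = if i ∈ l then [i] else [] := fun l hl => by
    induction l with
    | nil => simp
    | cons j l ih =>
      rw [List.nodup_cons] at hl
      rw [List.flatMap_cons, ih hl.2]
      rcases eq_or_ne i j with rfl | hij
      · simp [e, hl.1]
      · simp [e, hij, hij.symm]
  rw [word, h _ (List.nodup_finRange k), if_pos (List.mem_finRange i)]

end words

namespace Rep

variable {A : Type*} [NonUnitalCStarAlgebra A] [PartialOrder A] [StarOrderedRing A] {k : ℕ}
variable {X : ProductSystem A k}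
variable {H : Type*} [NormedAddCommGroup H] [InnerProductSpace ℂ H] [CompleteSpace H]
variable {K : Type*} [NormedAddCommGroup K] [InnerProductSpace ℂ K] [CompleteSpace K]

theorem tilde_tmul (R : Rep X H) (i : Fin k) (ξ : X.E (e i)) (h : H) :
    R.tilde i (Tensor.tmul R.σ ξ h) = R.T i ξ h := (R.isRep i).tilde_tmul ξ h

theorem tildeAt_zero_tmul (R : Rep X H) (a : A) (h : H) :
    R.tildeAt 0 (Tensor.tmul R.σ (X.one a) h) = R.σ a h := by
  have key : ∀ (w : List (Fin k)) (hw : degree w = 0), w = [] →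
      (R.tildeWord w 0 hw).1 (Tensor.tmul R.σ (X.one a) h) = R.σ a h := by
    rintro _ hw rfl
    exact tilde_zero_tmul X R.σ a h
  exact key _ _ word_zero

theorem tildeAt_e (R : Rep X H) (i : Fin k) : R.tildeAt (e i) = R.tilde i := by
  have key : ∀ (w : List (Fin k)) (hw : degree w = e i), w = [i] →
      (R.tildeWord w (e i) hw).1 = R.tilde i := by
    rintro _ hw rfl
    -- The operator of the word `i` maps `(ξ · a) ⊗ h` to `T ξ (σ a h)`.
    have h1 : R.tilde i ∘L Tensor.map (X.E (e i)) _ _ (ProdSys.tilde R.σ (X.zeroMap R.σ))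
          (tilde_zero_intertwines X R.σ)
        = R.tilde i ∘L (X.unit R.σ (add_zero (e i))).toContinuousLinearEquiv.toContinuousLinearMap := by
      refine Tensor.ext _ fun ξ z => ?_
      induction z using Tensor.induction with
      | hc =>
        have hc : Continuous fun z : Tensor (X.E 0) R.σ => Tensor.tmul (NDRep.induced _ R.σ) ξ z :=
          Tensor.continuous_tmul_right _ ξ
        exact isClosed_eq (by fun_prop) (by fun_prop)
      | h0 => simp [Tensor.tmul]
      | ha x y hx hy => simp only [Tensor.tmul_add_right, map_add, hx, hy]
      | ht η h =>
        obtain ⟨a, rfl⟩ := X.one.surjective η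
        change R.tilde i (Tensor.map _ _ _ _ _ _) = R.tilde i (X.unit R.σ (add_zero (e i)) _)
        rw [Tensor.map_tmul, tilde_zero_tmul, R.tilde_tmul, X.unit_tmul, X.mul_one, R.tilde_tmul,
          (R.isRep i).map_rsmul]
        rfl
    ext x
    obtain ⟨y, rfl⟩ := (X.unit R.σ (add_zero (e i))).surjective x
    refine Eq.trans ?_ (congrFun (congrArg DFunLike.coe h1) y)
    change R.tilde i (Tensor.map _ _ _ _ _
      ((X.unit R.σ (add_zero (e i))).symm (X.unit R.σ (add_zero (e i)) y))) = _
    rw [LinearIsometryEquiv.symm_apply_apply]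
    rfl
  exact key _ _ (word_e i)

/-- By the commutation relation, the range of `T̃ⁱ` is invariant under every `T^{(j)}(ξ)`. -/
theorem exists_apply_tilde_eq_tilde (S : Rep X K) (i j : Fin k) (ξ : X.E (e j))
    (x : Tensor (X.E (e i)) S.σ) : ∃ y, S.T j ξ (S.tilde i x) = S.tilde i y := by
  have h := congrFun (congrArg DFunLike.coe (S.comm j i)) (Tensor.tmul _ ξ x)
  simp only [ContinuousLinearMap.comp_apply, Tensor.map_tmul] at h
  exact ⟨_, (S.tilde_tmul j ξ _).symm.trans h⟩

namespace IsMinimalIsometricDilation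

variable {R : Rep X H} {S : Rep X K} {ι : H →ₗᵢ[ℂ] K}

/-- `V^{(i)}(ξ)` compresses to `T^{(i)}(ξ)`: the regularity condition in the degrees `0` and
`e i`. -/
theorem inner_embedding_apply (hS : R.IsMinimalIsometricDilation S ι) (i : Fin k) (ξ : X.E (e i))
    (g h : H) : ⟪S.T i ξ (ι h), ι g⟫_ℂ = ⟪R.T i ξ h, g⟫_ℂ := by
  have h1 : ∀ (a : A) (g : H), ⟪S.T i ξ (ι h), ι (R.σ a g)⟫_ℂ = ⟪R.T i ξ h, R.σ a g⟫_ℂ := by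
    intro a g
    have h2 := congrFun (congrArg DFunLike.coe (hS.regular 0 (e i) fun _ => Or.inl rfl))
      (Tensor.tmul R.σ ξ h)
    have h3 := congrArg (fun z => ⟪z, Tensor.tmul R.σ (X.one a) g⟫_ℂ) h2
    simp only [ContinuousLinearMap.comp_apply, ContinuousLinearMap.adjoint_inner_left,
      Tensor.map_tmul, tildeAt_zero_tmul, tildeAt_e, tilde_tmul] at h3
    rw [← hS.restrict] at h3
    exact h3
  have h2 : (innerSL ℂ (S.T i ξ (ι h))) ∘L ι.toContinuousLinearMap = innerSL ℂ (R.T i ξ h) :=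
    NDRep.ext_right (σ := R.σ) h1
  exact congrFun (congrArg DFunLike.coe h2) g

theorem adjoint_apply_embedding (hS : R.IsMinimalIsometricDilation S ι) (i : Fin k)
    (ξ : X.E (e i)) (h : H) : adjoint (S.T i ξ) (ι h) = ι (adjoint (R.T i ξ) h) := by
  obtain ⟨h', hh⟩ := hS.coinvariant i ξ h
  rw [hh]
  congr 1
  refine ext_inner_left ℂ fun g => ?_
  rw [← ι.inner_map_map, ← hh, ContinuousLinearMap.adjoint_inner_right, hS.inner_embedding_apply,
    ContinuousLinearMap.adjoint_inner_right]

/-- `Ṽⁱ⋆ ι = (I ⊗ ι) T̃ⁱ⋆` -/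
theorem adjoint_tilde_comp_embedding (hS : R.IsMinimalIsometricDilation S ι) (i : Fin k) :
    adjoint (S.tilde i) ∘L ι.toContinuousLinearMap
      = Tensor.map (X.E (e i)) _ _ ι.toContinuousLinearMap hS.restrict ∘L adjoint (R.tilde i) := by
  ext h
  refine Tensor.ext_inner_tmul fun ξ g => ?_
  rw [ContinuousLinearMap.comp_apply, ContinuousLinearMap.comp_apply,
    ContinuousLinearMap.adjoint_inner_right, S.tilde_tmul,
    ← ContinuousLinearMap.adjoint_inner_left (Tensor.map _ _ _ _ _), Tensor.adjoint_map,
    Tensor.map_tmul, ContinuousLinearMap.adjoint_inner_right, R.tilde_tmul,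
    ← ContinuousLinearMap.adjoint_inner_right, LinearIsometry.coe_toContinuousLinearMap,
    hS.adjoint_apply_embedding, ← ContinuousLinearMap.adjoint_inner_right (R.T i ξ),
    ContinuousLinearMap.adjoint_inner_left]
  rfl

/-- `ι⋆ Ṽⁱ Ṽⁱ⋆ ι = T̃ⁱ T̃ⁱ⋆` -/
theorem inner_adjoint_tilde_embedding (hS : R.IsMinimalIsometricDilation S ι) (i : Fin k)
    (g h : H) : ⟪adjoint (S.tilde i) (ι g), adjoint (S.tilde i) (ι h)⟫_ℂ
      = ⟪adjoint (R.tilde i) g, adjoint (R.tilde i) h⟫_ℂ := by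
  have key : ∀ h : H, adjoint (S.tilde i) (ι h)
      = Tensor.map (X.E (e i)) _ _ ι.toContinuousLinearMap hS.restrict (adjoint (R.tilde i) h) :=
    fun h => congrFun (congrArg DFunLike.coe (hS.adjoint_tilde_comp_embedding i)) h
  rw [key, key, ← ContinuousLinearMap.adjoint_inner_right, ← ContinuousLinearMap.comp_apply,
    Tensor.adjoint_map_comp_map, ContinuousLinearMap.id_apply]

theorem fullyCoisometric_of_dilation (hS : R.IsMinimalIsometricDilation S ι)
    (hc : S.FullyCoisometric) : R.FullyCoisometric := fun i => by
  ext h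
  refine ext_inner_left ℂ fun g => ?_
  rw [ContinuousLinearMap.comp_apply, ← ContinuousLinearMap.adjoint_inner_left,
    ← hS.inner_adjoint_tilde_embedding, ContinuousLinearMap.adjoint_inner_left,
    ← ContinuousLinearMap.comp_apply, hc i]
  exact ι.inner_map_map g h

theorem dilation_fullyCoisometric (hS : R.IsMinimalIsometricDilation S ι)
    (hc : R.FullyCoisometric) : S.FullyCoisometric := fun i => by
  have hi : ∀ y, S.tilde i (adjoint (S.tilde i) (S.tilde i y)) = S.tilde i y := fun y =>
    congrArg (S.tilde i) (congrFun (congrArg DFunLike.coe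
      ((S.isRep i).adjoint_tilde_comp_tilde (hS.isometric i))) y)
  -- The subspace of vectors fixed by `Ṽⁱ Ṽⁱ⋆`, i.e. the range of the isometry `Ṽⁱ`.
  let M : Submodule ℂ K := LinearMap.eqLocus
    ((S.tilde i ∘L adjoint (S.tilde i) : K →L[ℂ] K) : K →ₗ[ℂ] K) LinearMap.id
  have hM : M = ⊤ := by
    refine hS.minimal M (isClosed_eq
      (S.tilde i ∘L adjoint (S.tilde i)).continuous continuous_id) (fun h => ?_) fun j ξ x hx => ?_
    · refine apply_adjoint_eq_self_of_norm_eq (S.isRep i).norm_tilde_le ?_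
      rw [← sq_eq_sq₀ (norm_nonneg _) (norm_nonneg _), ← inner_self_eq_norm_sq (𝕜 := ℂ),
        hS.inner_adjoint_tilde_embedding, ContinuousLinearMap.adjoint_inner_left,
        ← ContinuousLinearMap.comp_apply, hc i, ContinuousLinearMap.id_apply,
        inner_self_eq_norm_sq, ι.norm_map]
    · have hx' : S.tilde i (adjoint (S.tilde i) x) = x := hx
      obtain ⟨y, hy⟩ := S.exists_apply_tilde_eq_tilde i j ξ (adjoint (S.tilde i) x)
      rw [hx'] at hy
      rw [hy]
      exact hi y
  ext x
  exact (hM ▸ Submodule.mem_top : x ∈ M)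

end IsMinimalIsometricDilation

end Rep

end

end ProdSys

theorem proposition2p5 {A : Type*} [NonUnitalCStarAlgebra A] [PartialOrder A] [StarOrderedRing A]
    {k : ℕ} (X : ProdSys.ProductSystem A k)
    {H : Type*} [NormedAddCommGroup H] [InnerProductSpace ℂ H] [CompleteSpace H]
    {K : Type*} [NormedAddCommGroup K] [InnerProductSpace ℂ K] [CompleteSpace K]
    (R : ProdSys.Rep X H) (S : ProdSys.Rep X K) (ι : H →ₗᵢ[ℂ] K)
    (hR : R.DoublyCommuting) (hS : R.IsMinimalIsometricDilation S ι) :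
    S.FullyCoisometric ↔ R.FullyCoisometric :=
  ⟨hS.fullyCoisometric_of_dilation, hS.dilation_fullyCoisometric⟩
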